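/- Let $d\ge 1$ be an integer and $q\in\mathbb C\setminus\{0\}$. For $n\ge 0$ let $\mathcal F_n$ be the framed braid group, generated by $\sigma_1,\dots,\sigma_{n-1},t_1,\dots,t_n$ subject to $\sigma_i\sigma_j\sigma_i=\sigma_j\sigma_i\sigma_j$ for $|i-j|=1$, $\sigma_i\sigma_j=\sigma_j\sigma_i$ for $|i-j|>1$, $t_it_j=t_jt_i$ and $t_j\sigma_i=\sigma_it_{s_i(j)}$, where $s_i$ is the transposition $(i,i+1)$. Let $\mathcal F_{d,n}$ be the quotient of $\mathcal F_n$ by the relations $t_j^d=1$, and let $\mathrm Y_{d,n}(q)$ be the Yokonuma–Hecke algebra, i.e. the quotient of the group algebra $\mathbb C\mathcal F_{d,n}$ by the two-sided ideal generated by the elements $\sigma_i^2-1-(q-q^{-1})e_i\sigma_i$ $(1\le i\le n-1)$, where $e_i=\frac1d\sum_{s=1}^{d}t_i^st_{i+1}^{-s}$. Write $g_i$ for the image of $\sigma_i$. There is a unique linear map $$\mathrm{tr}_d:\bigcup_{n\ge 0}\mathrm Y_{d,n}(q)\to\mathbb C[z,x_1,\dots,x_{d-1}]$$ (that is, a unique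 family of $\mathbb C$-linear maps on the $\mathrm Y_{d,n}(q)$, compatible with the natural inclusions $\mathrm Y_{d,n}(q)\to\mathrm Y_{d,n+1}(q)$) such that, for all $n$, (1) $\mathrm{tr}_d(ab)=\mathrm{tr}_d(ba)$ for $a,b\in\mathrm Y_{d,n}(q)$; (2) $\mathrm{tr}_d(1)=1$; (3) $\mathrm{tr}_d(ag_n)=z\,\mathrm{tr}_d(a)$ for $a\in\mathrm Y_{d,n}(q)$, $n\ge1$; (4) $\mathrm{tr}_d(at_{n+1}^s)=x_s\,\mathrm{tr}_d(a)$ for $a\in\mathrm Y_{d,n}(q)$, $1\le s\le d-1$. Let $a\mapsto\overleftarrow a$ be inversion, which writes words from right to left: the linear anti-automorphism of $\mathrm Y_{d,n}(q)$ (respectively the anti-automorphism of the group $\mathcal F_n$) that fixes all generators $g_i$ (respectively $\sigma_i$) and $t_j$. Then the trace $\mathrm{tr}_d$ is invariant under inversion: for all $n$, $$\mathrm{tr}_d(a)=\mathrm{tr}_d(\overleftarrow a)\qquad\text{for all }a\in\mathrm Y_{d,n}(q).$$ In particular $\mathrm{tr}_d(\alpha)=\mathrm{tr}_d(\overleftarrow\alpha)$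 for all framed braids $\alpha\in\mathcal F_n$, where $\mathrm{tr}_d$ is evaluated on $\mathcal F_n$ through the natural map $\mathcal F_n\to\mathrm Y_{d,n}(q)$. -/

import Mathlib

noncomputable section

namespace YokonumaHecke

/-! Strands are numbered from `0`: `σ i` (with `i + 1 < n`) is the braiding generator that
exchanges the strands `i` and `i + 1`, and `t j` is the framing generator of the strand `j`. -/

/-- The generators of the framed braid group on `n` strands. -/
inductive Gen (n : ℕ) : Type
  | σ (i : ℕ) (hi : i + 1 < n) : Gen n
  | t (j : Fin n) : Gen n

/-- The braiding generator as an element of the free group. -/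
def fσ {n : ℕ} (i : ℕ) (hi : i + 1 < n) : FreeGroup (Gen n) := FreeGroup.of (Gen.σ i hi)

/-- The framing generator as an element of the free group. -/
def ft {n : ℕ} (j : Fin n) : FreeGroup (Gen n) := FreeGroup.of (Gen.t j)

/-- The transposition `s_i = (i, i + 1)` of the strands. -/
def strandSwap {n : ℕ} (i : ℕ) (hi : i + 1 < n) : Equiv.Perm (Fin n) :=
  Equiv.swap ⟨i, by omega⟩ ⟨i + 1, hi⟩

/-- The defining relations (left side, right side) of the framed braid group. -/
inductive FramedRel (n : ℕ) : FreeGroup (Gen n) → FreeGroup (Gen n) → Prop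
  | b₁ (i j : ℕ) (hi : i + 1 < n) (hj : j + 1 < n) (hij : i + 1 = j ∨ j + 1 = i) :
      FramedRel n (fσ i hi * fσ j hj * fσ i hi) (fσ j hj * fσ i hi * fσ j hj)
  | b₂ (i j : ℕ) (hi : i + 1 < n) (hj : j + 1 < n) (hij : i + 1 < j ∨ j + 1 < i) :
      FramedRel n (fσ i hi * fσ j hj) (fσ j hj * fσ i hi)
  | f₁ (i j : Fin n) : FramedRel n (ft i * ft j) (ft j * ft i)
  | f₂ (i : ℕ) (hi : i + 1 < n) (j : Fin n) :
      FramedRel n (ft j * fσ i hi) (fσ i hi * ft (strandSwap i hi j))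

/-- The defining relations of the modular framed braid group: those of the framed braid group
and `t_j ^ d = 1`. -/
inductive ModularRel (d n : ℕ) : FreeGroup (Gen n) → FreeGroup (Gen n) → Prop
  | framed {u v : FreeGroup (Gen n)} (h : FramedRel n u v) : ModularRel d n u v
  | m (j : Fin n) : ModularRel d n (ft j ^ d) 1

/-- The relators `u * v⁻¹` of a family of relations `u = v`. -/
def relators {α : Type} (r : FreeGroup α → FreeGroup α → Prop) : Set (FreeGroup α) :=
  {w | ∃ u v, r u v ∧ w = u * v⁻¹}

/-- The framed braid group `F_n`. -/
abbrev FramedBraidGroup (n : ℕ) : Type := PresentedGroup (relators (FramedRel n))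

/-- The modular framed braid group `F_{d,n}`. -/
abbrev ModularFramedBraidGroup (d n : ℕ) : Type := PresentedGroup (relators (ModularRel d n))

/-- A map on generators that respects a family of relations extends to the presented group. -/
def liftRel {α : Type} {r : FreeGroup α → FreeGroup α → Prop} {G : Type} [Group G] (f : α → G)
    (h : ∀ u v, r u v → FreeGroup.lift f u = FreeGroup.lift f v) :
    PresentedGroup (relators r) →* G :=
  PresentedGroup.toGroup (f := f) (by
    rintro w ⟨u, v, huv, rfl⟩
    simp [h u v huv])

@[simp] theorem liftRel_of {α : Type} {r : FreeGroup α → FreeGroup α → Prop} {G : Type} [Group G]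
    (f : α → G) (h : ∀ u v, r u v → FreeGroup.lift f u = FreeGroup.lift f v) (x : α) :
    liftRel f h (PresentedGroup.of x) = f x :=
  PresentedGroup.toGroup.of _

theorem lift_of_eq {α : Type} {r : FreeGroup α → FreeGroup α → Prop} {u v : FreeGroup α}
    (h : r u v) :
    FreeGroup.lift (fun x => (PresentedGroup.of x : PresentedGroup (relators r))) u =
      FreeGroup.lift (fun x => (PresentedGroup.of x : PresentedGroup (relators r))) v := by
  have key : FreeGroup.lift (fun x => (PresentedGroup.of x : PresentedGroup (relators r))) =
      PresentedGroup.mk (relators r) := by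
    ext x; simp [PresentedGroup.of]
  rw [key]
  have : PresentedGroup.mk (relators r) (u * v⁻¹) = 1 :=
    PresentedGroup.one_of_mem ⟨u, v, h, rfl⟩
  rw [map_mul, map_inv] at this
  exact mul_inv_eq_one.mp this

/-- The braiding generator `σ_i` of `F_{d,n}`. -/
def mσ (d : ℕ) {n : ℕ} (i : ℕ) (hi : i + 1 < n) : ModularFramedBraidGroup d n :=
  PresentedGroup.of (Gen.σ i hi)

/-- The framing generator `t_j` of `F_{d,n}`. -/
def mt (d : ℕ) {n : ℕ} (j : Fin n) : ModularFramedBraidGroup d n :=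
  PresentedGroup.of (Gen.t j)

/-- The natural epimorphism `F_n → F_{d,n}`. -/
def toModular (d n : ℕ) : FramedBraidGroup n →* ModularFramedBraidGroup d n :=
  liftRel (fun x => PresentedGroup.of x) (fun _ _ h => lift_of_eq (ModularRel.framed h))

/-! ### Relations in the modular framed braid group -/

theorem mσ_braid (d : ℕ) {n : ℕ} (i j : ℕ) (hi : i + 1 < n) (hj : j + 1 < n)
    (hij : i + 1 = j ∨ j + 1 = i) :
    mσ d i hi * mσ d j hj * mσ d i hi = mσ d j hj * mσ d i hi * mσ d j hj := by
  simpa [fσ, mσ] using lift_of_eq (ModularRel.framed (d := d) (FramedRel.b₁ i j hi hj hij))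

theorem mσ_comm (d : ℕ) {n : ℕ} (i j : ℕ) (hi : i + 1 < n) (hj : j + 1 < n)
    (hij : i + 1 < j ∨ j + 1 < i) :
    mσ d i hi * mσ d j hj = mσ d j hj * mσ d i hi := by
  simpa [fσ, mσ] using lift_of_eq (ModularRel.framed (d := d) (FramedRel.b₂ i j hi hj hij))

theorem mt_comm (d : ℕ) {n : ℕ} (i j : Fin n) : mt d i * mt d j = mt d j * mt d i := by
  simpa [ft, mt] using lift_of_eq (ModularRel.framed (d := d) (FramedRel.f₁ i j))

theorem mt_mul_mσ (d : ℕ) {n : ℕ} (i : ℕ) (hi : i + 1 < n) (j : Fin n) :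
    mt d j * mσ d i hi = mσ d i hi * mt d (strandSwap i hi j) := by
  simpa [ft, fσ, mt, mσ] using lift_of_eq (ModularRel.framed (d := d) (FramedRel.f₂ i hi j))

theorem mt_pow (d : ℕ) {n : ℕ} (j : Fin n) : mt d j ^ d = 1 := by
  simpa [ft, mt] using lift_of_eq (ModularRel.m (d := d) j)

/-! ### The Yokonuma–Hecke algebra -/

/-- The element `e_i = (1/d) ∑_{s=1}^{d} t_i^s t_{i+1}^{-s}` of `ℂ F_{d,n}`. -/
def e (d : ℕ) {n : ℕ} (i : ℕ) (hi : i + 1 < n) :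
    MonoidAlgebra ℂ (ModularFramedBraidGroup d n) :=
  (d : ℂ)⁻¹ • ∑ s ∈ Finset.Icc 1 d,
    MonoidAlgebra.of ℂ _ (mt d ⟨i, by omega⟩ ^ s * (mt d ⟨i + 1, hi⟩ ^ s)⁻¹)

/-- The braiding generator `σ_i` in `ℂ F_{d,n}`. -/
def aσ (d : ℕ) {n : ℕ} (i : ℕ) (hi : i + 1 < n) :
    MonoidAlgebra ℂ (ModularFramedBraidGroup d n) :=
  MonoidAlgebra.of ℂ _ (mσ d i hi)

/-- The quadratic relations `σ_i² = 1 + (q - q⁻¹) e_i σ_i`. -/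
inductive QuadRel (d n : ℕ) (q : ℂ) :
    MonoidAlgebra ℂ (ModularFramedBraidGroup d n) →
      MonoidAlgebra ℂ (ModularFramedBraidGroup d n) → Prop
  | quad (i : ℕ) (hi : i + 1 < n) :
      QuadRel d n q (aσ d i hi ^ 2) (1 + (q - q⁻¹) • (e d i hi * aσ d i hi))

/-- The Yokonuma–Hecke algebra `Y_{d,n}(q)`: the quotient of `ℂ F_{d,n}` by the two-sided ideal
generated by the elements `σ_i² - 1 - (q - q⁻¹) e_i σ_i`. -/
abbrev YH (d n : ℕ) (q : ℂ) : Type := RingQuot (QuadRel d n q)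

/-- The natural map `F_{d,n} → Y_{d,n}(q)`. -/
def ofModular (d n : ℕ) (q : ℂ) : ModularFramedBraidGroup d n →* YH d n q :=
  ((RingQuot.mkAlgHom ℂ (QuadRel d n q) : _ →* YH d n q)).comp (MonoidAlgebra.of ℂ _)

/-- The natural map `F_n → Y_{d,n}(q)`. -/
def ofFramedBraid (d n : ℕ) (q : ℂ) : FramedBraidGroup n →* YH d n q :=
  (ofModular d n q).comp (toModular d n)

/-- The element `g_i` of `Y_{d,n}(q)`. -/
def g (d : ℕ) {n : ℕ} (q : ℂ) (i : ℕ) (hi : i + 1 < n) : YH d n q := ofModular d n q (mσ d i hi)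

/-- The element `t_j` of `Y_{d,n}(q)`. -/
def t (d : ℕ) {n : ℕ} (q : ℂ) (j : Fin n) : YH d n q := ofModular d n q (mt d j)

theorem mkAlgHom_of (d n : ℕ) (q : ℂ) (x : ModularFramedBraidGroup d n) :
    RingQuot.mkAlgHom ℂ (QuadRel d n q) (MonoidAlgebra.of ℂ _ x) = ofModular d n q x := rfl

theorem quad_eq (d n : ℕ) (q : ℂ) (i : ℕ) (hi : i + 1 < n) :
    ofModular d n q (mσ d i hi) ^ 2 = 1 + (q - q⁻¹) • ((d : ℂ)⁻¹ • ∑ s ∈ Finset.Icc 1 d,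
      ofModular d n q (mt d ⟨i, by omega⟩ ^ s * (mt d ⟨i + 1, hi⟩ ^ s)⁻¹) *
        ofModular d n q (mσ d i hi)) := by
  have h := RingQuot.mkAlgHom_rel ℂ (QuadRel.quad (q := q) (d := d) i hi)
  simp only [e, aσ, map_pow, map_add, map_one, map_smul, map_mul, map_sum,
    mkAlgHom_of, Finset.sum_mul, smul_mul_assoc] at h ⊢
  exact h

/-! ### The natural inclusions -/

/-- The inclusion `F_{d,n} → F_{d,n+1}` that adds a last strand. -/
def modularIncl (d n : ℕ) : ModularFramedBraidGroup d n →* ModularFramedBraidGroup d (n + 1) :=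
  liftRel
    (fun x => match x with
      | Gen.σ i hi => mσ d i (Nat.lt_succ_of_lt hi)
      | Gen.t j => mt d j.castSucc)
    (by
      rintro u v (h | ⟨j⟩)
      · cases h with
        | b₁ i j hi hj hij => simpa [fσ] using mσ_braid d i j _ _ hij
        | b₂ i j hi hj hij => simpa [fσ] using mσ_comm d i j _ _ hij
        | f₁ i j => simpa [ft] using mt_comm d _ _
        | f₂ i hi j =>
          have hs : (strandSwap i hi j).castSucc =
              strandSwap i (Nat.lt_succ_of_lt hi) j.castSucc := by
            simp only [strandSwap, Equiv.swap_apply_def, Fin.ext_iff]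
            split_ifs <;> simp_all
          simpa [ft, fσ, hs] using mt_mul_mσ d i _ j.castSucc
      · simpa [ft] using mt_pow d j.castSucc)

/-- The natural inclusion `Y_{d,n}(q) → Y_{d,n+1}(q)`, with `g_i ↦ g_i` and `t_j ↦ t_j`. -/
def incl (d n : ℕ) (q : ℂ) : YH d n q →ₐ[ℂ] YH d (n + 1) q :=
  RingQuot.liftAlgHom ℂ
    ⟨MonoidAlgebra.lift ℂ _ _ ((ofModular d (n + 1) q).comp (modularIncl d n)), by
      rintro x y ⟨i, hi⟩
      have h := quad_eq d (n + 1) q i (Nat.lt_succ_of_lt hi)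
      simp only [e, aσ, map_pow, map_add, map_one, map_smul, map_mul, map_sum, map_inv,
        Finset.sum_mul, smul_mul_assoc, MonoidAlgebra.lift_of, MonoidHom.comp_apply]
      simpa [modularIncl, mσ, mt, Finset.sum_mul] using h⟩

/-! ### Inversion (writing words from right to left) -/

/-- Inversion on the framed braid group, as a homomorphism to the opposite group: the
anti-automorphism with `σ_i ↦ σ_i` and `t_j ↦ t_j`. -/
def framedReverseHom (n : ℕ) : FramedBraidGroup n →* (FramedBraidGroup n)ᵐᵒᵖ :=
  liftRel (fun x => MulOpposite.op (PresentedGroup.of x)) (by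
    intro u v h
    apply MulOpposite.unop_injective
    cases h with
    | b₁ i j hi hj hij =>
      simpa [fσ, mul_assoc] using lift_of_eq (FramedRel.b₁ i j hi hj hij)
    | b₂ i j hi hj hij =>
      simpa [fσ] using lift_of_eq (FramedRel.b₂ j i hj hi hij.symm)
    | f₁ i j => simpa [ft] using lift_of_eq (FramedRel.f₁ j i)
    | f₂ i hi j =>
      have h := lift_of_eq (FramedRel.f₂ i hi (strandSwap i hi j))
      rw [show strandSwap i hi (strandSwap i hi j) = j by simp [strandSwap]] at h
      simpa [ft, fσ] using h.symm)

/-- The inverted framed braid: `σ_i` and `t_j` are kept and words are written from right to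
left. -/
def framedReverse (n : ℕ) (α : FramedBraidGroup n) : FramedBraidGroup n :=
  (framedReverseHom n α).unop

/-- Inversion on the modular framed braid group, as a homomorphism to the opposite group. -/
def modularReverseHom (d n : ℕ) :
    ModularFramedBraidGroup d n →* (ModularFramedBraidGroup d n)ᵐᵒᵖ :=
  liftRel (fun x => MulOpposite.op (PresentedGroup.of x)) (by
    rintro u v (h | ⟨j⟩)
    · apply MulOpposite.unop_injective
      cases h with
      | b₁ i j hi hj hij =>
        simpa [fσ, mσ, mul_assoc] using mσ_braid d i j hi hj hij
      | b₂ i j hi hj hij =>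
        simpa [fσ, mσ] using mσ_comm d j i hj hi hij.symm
      | f₁ i j => simpa [ft, mt] using mt_comm d j i
      | f₂ i hi j =>
        have h := mt_mul_mσ d i hi (strandSwap i hi j)
        rw [show strandSwap i hi (strandSwap i hi j) = j by simp [strandSwap]] at h
        simpa [ft, fσ, mt, mσ] using h.symm
    · apply MulOpposite.unop_injective
      simpa [ft, mt] using mt_pow d j)

theorem mσ_mul_frame (d : ℕ) {n : ℕ} (i : ℕ) (hi : i + 1 < n) (s : ℕ) (hs : s ≤ d) :
    mσ d i hi * ((mt d ⟨i + 1, hi⟩ ^ s)⁻¹ * mt d ⟨i, by omega⟩ ^ s) =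
      mt d ⟨i, by omega⟩ ^ (d - s) * (mt d ⟨i + 1, hi⟩ ^ (d - s))⁻¹ * mσ d i hi := by
  have h0 : mt d ⟨i, by omega⟩ * mσ d i hi = mσ d i hi * mt d ⟨i + 1, hi⟩ := by
    have := mt_mul_mσ d i hi ⟨i, by omega⟩
    simpa [strandSwap] using this
  have h1 : mt d ⟨i + 1, hi⟩ * mσ d i hi = mσ d i hi * mt d ⟨i, by omega⟩ := by
    have := mt_mul_mσ d i hi ⟨i + 1, hi⟩
    simpa [strandSwap] using this
  have hc : Commute (mt d (⟨i, by omega⟩ : Fin n)) (mt d ⟨i + 1, hi⟩) := mt_comm d _ _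
  have hp (j : Fin n) : mt d j ^ (d - s) = (mt d j ^ s)⁻¹ := by
    rw [eq_inv_iff_mul_eq_one, ← pow_add, Nat.sub_add_cancel hs, mt_pow]
  have hs0 : SemiconjBy (mσ d i hi) (mt d ⟨i + 1, hi⟩) (mt d ⟨i, by omega⟩) := h0.symm
  have hs1 : SemiconjBy (mσ d i hi) (mt d ⟨i, by omega⟩) (mt d ⟨i + 1, hi⟩) := h1.symm
  rw [hp, hp, inv_inv]
  exact ((hs0.pow_right s).inv_right.mul_right (hs1.pow_right s)).eq

theorem sum_Icc_reflect {M : Type} [AddCommGroup M] (d : ℕ) (f : ℕ → M) (h : f 0 = f d) :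
    ∑ s ∈ Finset.Icc 1 d, f s = ∑ s ∈ Finset.Icc 1 d, f (d - s) := by
  have h1 : ∑ s ∈ Finset.Icc 1 d, f s = ∑ k ∈ Finset.range d, f (k + 1) := by
    rw [← Finset.Ico_add_one_right_eq_Icc, Finset.sum_Ico_eq_sum_range]
    simp [add_comm]
  have h2 : ∑ s ∈ Finset.Icc 1 d, f (d - s) = ∑ k ∈ Finset.range d, f (d - 1 - k) := by
    rw [← Finset.Ico_add_one_right_eq_Icc, Finset.sum_Ico_eq_sum_range]
    simp [Nat.sub_sub]
  have h3 := Finset.sum_range_succ f d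
  rw [Finset.sum_range_succ', h] at h3
  rw [h1, h2, Finset.sum_range_reflect]
  exact add_right_cancel h3

/-- Inversion on `Y_{d,n}(q)`, as an algebra homomorphism to the opposite algebra: the
anti-automorphism with `g_i ↦ g_i` and `t_j ↦ t_j`. -/
def reverseHom (d n : ℕ) (q : ℂ) : YH d n q →ₐ[ℂ] (YH d n q)ᵐᵒᵖ :=
  RingQuot.liftAlgHom ℂ
    ⟨MonoidAlgebra.lift ℂ _ _
      ((MonoidHom.op (ofModular d n q)).comp (modularReverseHom d n)), by
      rintro x y ⟨i, hi⟩
      apply MulOpposite.unop_injective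
      have h := quad_eq d n q i hi
      have hrσ : modularReverseHom d n (mσ d i hi) = MulOpposite.op (mσ d i hi) :=
        liftRel_of _ _ _
      have hrt (j : Fin n) : modularReverseHom d n (mt d j) = MulOpposite.op (mt d j) :=
        liftRel_of _ _ _
      simp only [e, aσ, map_pow, map_add, map_one, map_smul, map_mul, map_sum, map_inv,
        Finset.sum_mul, smul_mul_assoc, MonoidAlgebra.lift_of, MonoidHom.comp_apply, hrσ, hrt]
      simp only [MulOpposite.unop_add, MulOpposite.unop_smul, Finset.unop_sum,
        MulOpposite.unop_one,
        ← MulOpposite.op_pow, ← MulOpposite.op_inv, ← MulOpposite.op_mul,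
        MonoidHom.op_apply_apply, MulOpposite.unop_op, Function.comp]
      rw [h]
      simp only [← map_mul]
      congr 3
      rw [sum_Icc_reflect d _ (by simp [mt_pow])]
      refine Finset.sum_congr rfl fun s hs => ?_
      rw [← map_pow, ← map_mul, ← map_mul, mσ_mul_frame d i hi s (Finset.mem_Icc.mp hs).2]⟩

/-- The inversion map `a ↦ a` written from right to left on `Y_{d,n}(q)`. -/
def reverse (d n : ℕ) (q : ℂ) : YH d n q →ₗ[ℂ] YH d n q :=
  (MulOpposite.opLinearEquiv ℂ).symm.toLinearMap ∘ₗ (reverseHom d n q).toLinearMap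

theorem reverse_mul (d n : ℕ) (q : ℂ) (a b : YH d n q) :
    reverse d n q (a * b) = reverse d n q b * reverse d n q a := by
  simp [reverse]

theorem reverse_g (d n : ℕ) (q : ℂ) (i : ℕ) (hi : i + 1 < n) :
    reverse d n q (g d q i hi) = g d q i hi := by
  have h : modularReverseHom d n (mσ d i hi) = MulOpposite.op (mσ d i hi) := liftRel_of _ _ _
  simp [reverse, reverseHom, g, ofModular, h, MonoidAlgebra.lift_of, -MonoidAlgebra.of_apply]

theorem reverse_t (d n : ℕ) (q : ℂ) (j : Fin n) :
    reverse d n q (t d q j) = t d q j := by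
  have h : modularReverseHom d n (mt d j) = MulOpposite.op (mt d j) := liftRel_of _ _ _
  simp [reverse, reverseHom, t, ofModular, h, MonoidAlgebra.lift_of, -MonoidAlgebra.of_apply]

/-! ### The trace -/

/-- The indeterminates `z, x_1, …, x_{d-1}`. -/
inductive TraceVar (d : ℕ) : Type
  | z : TraceVar d
  | x (s : ℕ) (h₁ : 1 ≤ s) (h₂ : s < d) : TraceVar d

/-- The polynomial ring `ℂ[z, x_1, …, x_{d-1}]`. -/
abbrev TraceRing (d : ℕ) : Type := MvPolynomial (TraceVar d) ℂ

/-- `tr` is a Markov trace `⋃ₙ Y_{d,n}(q) → ℂ[z, x_1, …, x_{d-1}]`. A linear map on the union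
is a family of linear maps on the `Y_{d,n}(q)` compatible with the natural inclusions. With
strands numbered from `0`, the generator `g_n` of `Y_{d,n+1}(q)` of the usual numbering is
`g (n - 1)`; so, with `n = m + 1` in `markov`, it is `g m`, and `t_{n+1}` is `t (Fin.last n)`. -/
structure IsMarkovTrace (d : ℕ) (q : ℂ) (tr : (n : ℕ) → YH d n q →ₗ[ℂ] TraceRing d) : Prop where
  compat : ∀ (n : ℕ) (a : YH d n q), tr (n + 1) (incl d n q a) = tr n a
  comm : ∀ (n : ℕ) (a b : YH d n q), tr n (a * b) = tr n (b * a)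
  one : ∀ n : ℕ, tr n 1 = 1
  markov : ∀ (m : ℕ) (a : YH d (m + 1) q),
    tr (m + 2) (incl d (m + 1) q a * g d q m (Nat.lt_succ_self (m + 1))) =
      MvPolynomial.X TraceVar.z * tr (m + 1) a
  framing : ∀ (n : ℕ) (a : YH d n q) (s : ℕ) (h₁ : 1 ≤ s) (h₂ : s < d),
    tr (n + 1) (incl d n q a * t d q (Fin.last n) ^ s) =
      MvPolynomial.X (TraceVar.x s h₁ h₂) * tr n a

end YokonumaHecke

end

/-!
As a right module over `F = Y_{d,n}(q)[t_{n+1}]`, the algebra `Y_{d,n+1}(q)` should be the sum of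
the cosets `g_k ⋯ g_n F` with `1 ≤ k ≤ n + 1`. The generators act on the abstract sum of `n + 1`
copies of `F` by the formulas this suggests, and the coefficients of `t_{n+1}^s` and of `g_n` in the
orbit of `1` give `Y_{d,n}(q)`-bimodule maps `Y_{d,n+1}(q) → Y_{d,n}(q)`. Combining these maps with
weights `x_s` and `z` defines `tr` on `Y_{d,n+1}(q)` from `tr` on `Y_{d,n}(q)`.

The elements `a t_{n+1}^s` and `a g_n b` with `a, b ∈ Y_{d,n}(q)` span `Y_{d,n+1}(q)`, and the rules
determine a trace on them, which gives uniqueness. On the same elements the trace property reduces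
by induction to `tr (a g_n) = tr (g_n a)`, that is, to the symmetry of the form
`(a, b) ↦ tr (g_n a g_n b)` on `Y_{d,n}(q)`, which is checked on products of spanning elements of
`Y_{d,n}(q)`.

Inversion exchanges the two sides of a product and fixes the generators, so `a ↦ tr (reverse a)`
satisfies the rules as well, and it equals `tr` by uniqueness.
-/

noncomputable section

namespace YokonumaHecke

/-! ### Averages over the framings of two strands -/

/-- The average `(1/d) ∑_{s<d} u^s v^{d-s}`. For commuting `u` and `v` with `u^d = v^d = 1` it is
the element `(1/d) ∑ u^s v^{-s}` of the quadratic relation, written without inverses. -/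
def frameAvg (d : ℕ) {A : Type*} [Ring A] [Algebra ℂ A] (u v : A) : A :=
  (d : ℂ)⁻¹ • ∑ s ∈ Finset.range d, u ^ s * v ^ (d - s)

section frameAvg

variable {d : ℕ} {A B : Type*} [Ring A] [Algebra ℂ A] [Ring B] [Algebra ℂ B]

theorem linearMap_pow_mul {L : B →ₗ[ℂ] A} {x : B} {x' : A} (hx : ∀ b, L (x * b) = x' * L b)
    (k : ℕ) (b : B) : L (x ^ k * b) = x' ^ k * L b := by
  induction k generalizing b with
  | zero => simp
  | succ k ih => rw [pow_succ, pow_succ, mul_assoc, mul_assoc, ih, hx]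

theorem linearMap_frameAvg_mul {L : B →ₗ[ℂ] A} {x y : B} {x' y' : A}
    (hx : ∀ b, L (x * b) = x' * L b) (hy : ∀ b, L (y * b) = y' * L b) (b : B) :
    L (frameAvg d x y * b) = frameAvg d x' y' * L b := by
  simp only [frameAvg, smul_mul_assoc, Finset.sum_mul, map_smul, map_sum, mul_assoc,
    linearMap_pow_mul hx, linearMap_pow_mul hy]

theorem map_frameAvg (φ : B →ₐ[ℂ] A) (x y : B) :
    φ (frameAvg d x y) = frameAvg d (φ x) (φ y) := by
  simp only [frameAvg, map_smul, map_sum, map_mul, map_pow]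

theorem semiconjBy_frameAvg {x u v u' v' : A} (hu : SemiconjBy x u u') (hv : SemiconjBy x v v') :
    SemiconjBy x (frameAvg d u v) (frameAvg d u' v') := by
  simp only [SemiconjBy, frameAvg, mul_smul_comm, smul_mul_assoc, Finset.mul_sum, Finset.sum_mul]
  congr! 2 with s
  exact (hu.pow_right s).mul_right (hv.pow_right (d - s))

theorem frameAvg_eq_geom_sum_mul (u v : A) :
    frameAvg d u v = (d : ℂ)⁻¹ • ((∑ s ∈ Finset.range d, u ^ s * v ^ (d - 1 - s)) * v) := by
  simp only [frameAvg, Finset.sum_mul, mul_assoc, ← pow_succ]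
  congr! 4 with s hs
  have := Finset.mem_range.mp hs
  omega

theorem mul_geom_sum_eq {R : Type*} [Ring R] {u v : R} (h : Commute u v) (hu : u ^ d = 1)
    (hv : v ^ d = 1) :
    u * ∑ s ∈ Finset.range d, u ^ s * v ^ (d - 1 - s) =
      v * ∑ s ∈ Finset.range d, u ^ s * v ^ (d - 1 - s) := by
  rw [← sub_eq_zero, ← sub_mul, h.mul_geom_sum₂, hu, hv, sub_self]

theorem commute_geom_sum_right {R : Type*} [Semiring R] {u v : R} (h : Commute u v) :
    Commute (∑ s ∈ Finset.range d, u ^ s * v ^ (d - 1 - s)) v :=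
  Commute.sum_left _ _ _ fun s _ => (h.pow_left s).mul_left ((Commute.refl v).pow_left _)

theorem mul_frameAvg_absorb {u v : A} (h : Commute u v) (hu : u ^ d = 1) (hv : v ^ d = 1) :
    u * frameAvg d u v = v * frameAvg d u v := by
  simp only [frameAvg_eq_geom_sum_mul, mul_smul_comm, ← mul_assoc, mul_geom_sum_eq h hu hv]

theorem frameAvg_comm {u v : A} (h : Commute u v) (hu : u ^ d = 1) (hv : v ^ d = 1) :
    frameAvg d u v = frameAvg d v u := by
  rw [frameAvg_eq_geom_sum_mul, frameAvg_eq_geom_sum_mul, (commute_geom_sum_right h).eq,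
    ← mul_geom_sum_eq h hu hv, h.geom_sum₂_comm, (commute_geom_sum_right h.symm).eq]

theorem pow_mul_frameAvg_absorb {u v : A} (h : Commute u v) (hu : u ^ d = 1) (hv : v ^ d = 1)
    (s : ℕ) : v ^ s * frameAvg d u v = u ^ s * frameAvg d u v := by
  induction s with
  | zero => simp
  | succ s ih =>
    rw [pow_succ, mul_assoc, ← mul_frameAvg_absorb h hu hv, ← mul_assoc, (h.symm.pow_left s).eq,
      mul_assoc, ih, ← mul_assoc, ← pow_succ']

theorem frameAvg_mul_frameAvg {u v w : A} (huv : Commute u v) (huw : Commute u w)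
    (hvw : Commute v w) (hu : u ^ d = 1) (hv : v ^ d = 1) :
    frameAvg d v w * frameAvg d u v = frameAvg d u w * frameAvg d u v := by
  conv_lhs => enter [1]; unfold frameAvg
  conv_rhs => enter [1]; unfold frameAvg
  simp only [smul_mul_assoc, Finset.sum_mul]
  congr! 2 with s
  rw [(hvw.pow_pow s (d - s)).eq, mul_assoc, pow_mul_frameAvg_absorb huv hu hv, ← mul_assoc,
    (huw.pow_pow s (d - s)).eq]

theorem sum_Icc_one_eq_sum_range {M : Type*} [AddCommGroup M] {f : ℕ → M} (h : f 0 = f d) :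
    ∑ s ∈ Finset.Icc 1 d, f s = ∑ s ∈ Finset.range d, f s := by
  have split_last := Finset.sum_range_succ f d
  rw [Finset.range_eq_Ico, Finset.sum_eq_sum_Ico_succ_bot (Nat.succ_pos d), h, add_comm,
    add_left_inj] at split_last
  simpa only [Finset.range_eq_Ico, zero_add, Nat.succ_eq_add_one,
    Finset.Ico_add_one_right_eq_Icc] using split_last

theorem smul_sum_Icc_mul_inv {u v : Aˣ} (hu : u ^ d = 1) (hv : v ^ d = 1) :
    (d : ℂ)⁻¹ • ∑ s ∈ Finset.Icc 1 d, ((u ^ s * (v ^ s)⁻¹ : Aˣ) : A) =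
      frameAvg d (u : A) (v : A) := by
  rw [frameAvg, sum_Icc_one_eq_sum_range (by simp [hu, hv])]
  congr! 2 with s hs
  have inv_pow_eq : (v ^ s)⁻¹ = v ^ (d - s) := by
    rw [inv_eq_iff_mul_eq_one, ← pow_add, Nat.add_sub_cancel' (Finset.mem_range.mp hs).le, hv]
  simp [inv_pow_eq]

end frameAvg

/-! ### The universal property -/

/-- The elements `g 0, …, g (n - 2)` and `t 0, …, t (n - 1)` of `A` satisfy the defining relations
of `Y_{d,n}(q)`. The values of `g` and `t` at other indices are irrelevant. -/
structure YHFamily (d n : ℕ) (q : ℂ) {A : Type*} [Ring A] [Algebra ℂ A] (g t : ℕ → A) :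
    Prop where
  braid : ∀ i, i + 2 < n → g i * g (i + 1) * g i = g (i + 1) * g i * g (i + 1)
  far : ∀ i j, i + 1 < j → j + 1 < n → Commute (g i) (g j)
  t_comm : ∀ i j, i < n → j < n → Commute (t i) (t j)
  t_mul_g : ∀ i j, i + 1 < n → j < n → t j * g i = g i * t (Equiv.swap i (i + 1) j)
  t_pow : ∀ j, j < n → t j ^ d = 1
  quad : ∀ i, i + 1 < n → g i * g i = 1 + (q - q⁻¹) • (frameAvg d (t i) (t (i + 1)) * g i)

theorem strandSwap_val {n : ℕ} (i : ℕ) (hi : i + 1 < n) (j : Fin n) :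
    (strandSwap i hi j : ℕ) = Equiv.swap i (i + 1) (j : ℕ) := by
  simp only [strandSwap, Equiv.swap_apply_def, Fin.ext_iff]
  split_ifs <;> rfl

namespace YHFamily

section relations

variable {d n : ℕ} {q : ℂ} {A : Type*} [Ring A] [Algebra ℂ A] {g t : ℕ → A}

theorem t_mul_g_self (h : YHFamily d n q g t) {i : ℕ} (hi : i + 1 < n) :
    t i * g i = g i * t (i + 1) := by
  rw [h.t_mul_g i i hi (by omega), Equiv.swap_apply_left]

theorem t_mul_g_succ (h : YHFamily d n q g t) {i : ℕ} (hi : i + 1 < n) :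
    t (i + 1) * g i = g i * t i := by
  rw [h.t_mul_g i (i + 1) hi hi, Equiv.swap_apply_right]

theorem commute_t_g (h : YHFamily d n q g t) {i j : ℕ} (hi : i + 1 < n) (hj : j < n)
    (hji : j ≠ i) (hji' : j ≠ i + 1) : Commute (t j) (g i) := by
  rw [Commute, SemiconjBy, h.t_mul_g i j hi hj, Equiv.swap_apply_of_ne_of_ne hji hji']

theorem commute_g_frameAvg (h : YHFamily d n q g t) {i : ℕ} (hi : i + 1 < n) :
    Commute (g i) (frameAvg d (t i) (t (i + 1))) := by
  have swap_frames : SemiconjBy (g i) (frameAvg d (t i) (t (i + 1)))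
      (frameAvg d (t (i + 1)) (t i)) :=
    semiconjBy_frameAvg (h.t_mul_g_succ hi).symm (h.t_mul_g_self hi).symm
  rwa [frameAvg_comm (h.t_comm _ _ hi (by omega)) (h.t_pow _ hi) (h.t_pow _ (by omega))]
    at swap_frames

theorem of_injective {B : Type*} [Ring B] [Algebra ℂ B] {φ : A →ₐ[ℂ] B}
    (hφ : Function.Injective φ) (h : YHFamily d n q (φ ∘ g) (φ ∘ t)) : YHFamily d n q g t where
  braid i hi := hφ (by simpa using h.braid i hi)
  far i j hij hj := hφ (by simpa using (h.far i j hij hj).eq)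
  t_comm i j hi hj := hφ (by simpa using (h.t_comm i j hi hj).eq)
  t_mul_g i j hi hj := hφ (by simpa using h.t_mul_g i j hi hj)
  t_pow j hj := hφ (by simpa using h.t_pow j hj)
  quad i hi := hφ (by simpa [map_frameAvg] using h.quad i hi)

end relations

section lift

variable {d n : ℕ} {q : ℂ} {A : Type} [Ring A] [Algebra ℂ A] {g t : ℕ → A}

/-- The element `g i` of a family as a unit: the quadratic relation makes it invertible. -/
def gUnit (h : YHFamily d n q g t) (i : ℕ) (hi : i + 1 < n) : Aˣ where
  val := g i
  inv := g i - (q - q⁻¹) • frameAvg d (t i) (t (i + 1))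
  val_inv := by
    rw [mul_sub, mul_smul_comm, (h.commute_g_frameAvg hi).eq, h.quad i hi, add_sub_cancel_right]
  inv_val := by rw [sub_mul, smul_mul_assoc, h.quad i hi, add_sub_cancel_right]

variable [NeZero d]

/-- The element `t j` of a family as a unit. -/
def tUnit (h : YHFamily d n q g t) (j : ℕ) (hj : j < n) : Aˣ :=
  Units.ofPowEqOne (t j) d (h.t_pow j hj) (NeZero.ne d)

/-- The group homomorphism from `F_{d,n}` to the units of `A` given by a family. -/
def groupHom (h : YHFamily d n q g t) : ModularFramedBraidGroup d n →* Aˣ :=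
  liftRel
    (fun x => match x with
      | Gen.σ i hi => h.gUnit i hi
      | Gen.t j => h.tUnit j j.2)
    (by
      rintro u v (h' | ⟨j⟩)
      · cases h' with
        | b₁ i j hi hj hij =>
          rcases hij with rfl | rfl
          · simpa [fσ, Units.ext_iff, gUnit] using h.braid i (by omega)
          · simpa [fσ, Units.ext_iff, gUnit] using (h.braid j (by omega)).symm
        | b₂ i j hi hj hij =>
          rcases hij with hij | hij
          · simpa [fσ, Units.ext_iff, gUnit] using (h.far i j hij hj).eq
          · simpa [fσ, Units.ext_iff, gUnit] using (h.far j i hij hi).eq.symm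
        | f₁ i j => simpa [ft, Units.ext_iff, tUnit] using (h.t_comm i j i.2 j.2).eq
        | f₂ i hi j =>
          simpa [ft, fσ, Units.ext_iff, tUnit, gUnit, strandSwap_val] using h.t_mul_g i j hi j.2
      · simp [ft, tUnit])

theorem groupHom_mσ (h : YHFamily d n q g t) (i : ℕ) (hi : i + 1 < n) :
    (h.groupHom (mσ d i hi) : A) = g i :=
  congrArg Units.val (liftRel_of _ _ _)

theorem groupHom_mt (h : YHFamily d n q g t) (j : Fin n) : (h.groupHom (mt d j) : A) = t j :=
  congrArg Units.val (liftRel_of _ _ _)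

/-- The algebra homomorphism from `Y_{d,n}(q)` given by a family. -/
def lift (h : YHFamily d n q g t) : YH d n q →ₐ[ℂ] A :=
  RingQuot.liftAlgHom ℂ
    ⟨MonoidAlgebra.lift ℂ _ _ ((Units.coeHom A).comp h.groupHom), by
      rintro x y ⟨i, hi⟩
      have avg_eq := smul_sum_Icc_mul_inv (d := d) (u := h.groupHom (mt d ⟨i, by omega⟩))
        (v := h.groupHom (mt d ⟨i + 1, hi⟩)) (by rw [← map_pow, mt_pow, map_one])
        (by rw [← map_pow, mt_pow, map_one])
      rw [h.groupHom_mt, h.groupHom_mt] at avg_eq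
      simp only [e, aσ, map_pow, map_add, map_one, map_smul, map_mul, map_sum,
        MonoidAlgebra.lift_of, MonoidHom.comp_apply, Units.coeHom_apply, h.groupHom_mσ, pow_two,
        h.quad i hi]
      rw [← avg_eq]
      simp [Units.val_mul]⟩

theorem lift_ofModular (h : YHFamily d n q g t) (x : ModularFramedBraidGroup d n) :
    h.lift (ofModular d n q x) = h.groupHom x := by
  simp [lift, ofModular, MonoidAlgebra.lift_of, -MonoidAlgebra.of_apply]

end lift

end YHFamily

/-- The generator `g_i` of `Y_{d,n}(q)`, indexed by all natural numbers: it is `1` when `i` is out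
of range. -/
def braidGen (d n : ℕ) (q : ℂ) (i : ℕ) : YH d n q := if h : i + 1 < n then g d q i h else 1

/-- The generator `t_j` of `Y_{d,n}(q)`, indexed by all natural numbers: it is `1` when `j` is out
of range. -/
def frameGen (d n : ℕ) (q : ℂ) (j : ℕ) : YH d n q := if h : j < n then t d q ⟨j, h⟩ else 1

section generators

variable {d n : ℕ} {q : ℂ}

theorem braidGen_eq {i : ℕ} (h : i + 1 < n) : braidGen d n q i = g d q i h := dif_pos h

theorem frameGen_eq {j : ℕ} (h : j < n) : frameGen d n q j = t d q ⟨j, h⟩ := dif_pos h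

theorem t_mul_g (i : ℕ) (hi : i + 1 < n) (j : Fin n) :
    t d q j * g d q i hi = g d q i hi * t d q (strandSwap i hi j) := by
  simpa only [map_mul, g, t] using congrArg (ofModular d n q) (mt_mul_mσ d i hi j)

theorem g_mul_g (i : ℕ) (hi : i + 1 < n) :
    g d q i hi * g d q i hi =
      1 + (q - q⁻¹) • (frameAvg d (t d q ⟨i, by omega⟩) (t d q ⟨i + 1, hi⟩) * g d q i hi) := by
  have avg_eq := smul_sum_Icc_mul_inv (d := d) (A := YH d n q)
    (u := (ofModular d n q).toHomUnits (mt d ⟨i, by omega⟩))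
    (v := (ofModular d n q).toHomUnits (mt d ⟨i + 1, hi⟩)) (by rw [← map_pow, mt_pow, map_one])
    (by rw [← map_pow, mt_pow, map_one])
  simp only [← map_pow, ← map_inv, ← map_mul, MonoidHom.coe_toHomUnits] at avg_eq
  rw [t, t, ← avg_eq, g, ← pow_two, quad_eq d n q i hi, smul_mul_assoc, Finset.sum_mul]

variable (d n q) in
theorem yhFamily_generators : YHFamily d n q (braidGen d n q) (frameGen d n q) where
  braid i hi := by
    rw [braidGen_eq hi, braidGen_eq (by omega)]
    simpa only [map_mul, g] using congrArg (ofModular d n q)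
      (mσ_braid d i (i + 1) (by omega) hi (Or.inl rfl))
  far i j hij hj := by
    rw [braidGen_eq hj, braidGen_eq (by omega)]
    simpa only [map_mul, Commute, SemiconjBy, g] using
      congrArg (ofModular d n q) (mσ_comm d i j (by omega) hj (Or.inl hij))
  t_comm i j hi hj := by
    rw [frameGen_eq hi, frameGen_eq hj]
    simpa only [map_mul, Commute, SemiconjBy, t] using
      congrArg (ofModular d n q) (mt_comm d ⟨i, hi⟩ ⟨j, hj⟩)
  t_mul_g i j hi hj := by
    have h := t_mul_g (d := d) (q := q) i hi ⟨j, hj⟩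
    rwa [← braidGen_eq, ← frameGen_eq, ← Fin.eta (strandSwap i hi ⟨j, hj⟩) (Fin.is_lt _),
      ← frameGen_eq, strandSwap_val] at h
  t_pow j hj := by
    rw [frameGen_eq hj]
    simpa only [map_pow, map_one, t] using congrArg (ofModular d n q) (mt_pow d ⟨j, hj⟩)
  quad i hi := by
    rw [braidGen_eq hi, frameGen_eq hi, frameGen_eq (by omega)]
    exact g_mul_g i hi

section lift

variable [NeZero d] {A : Type} [Ring A] [Algebra ℂ A] {g t : ℕ → A}

theorem YHFamily.lift_braidGen (h : YHFamily d n q g t) {i : ℕ} (hi : i + 1 < n) :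
    h.lift (braidGen d n q i) = g i := by
  rw [braidGen_eq hi, YokonumaHecke.g, h.lift_ofModular, h.groupHom_mσ]

theorem YHFamily.lift_frameGen (h : YHFamily d n q g t) {j : ℕ} (hj : j < n) :
    h.lift (frameGen d n q j) = t j := by
  rw [frameGen_eq hj, YokonumaHecke.t, h.lift_ofModular, h.groupHom_mt]

end lift

theorem algHom_ext {A : Type*} [Ring A] [Algebra ℂ A] {φ ψ : YH d n q →ₐ[ℂ] A}
    (hg : ∀ i, i + 1 < n → φ (braidGen d n q i) = ψ (braidGen d n q i))
    (ht : ∀ j, j < n → φ (frameGen d n q j) = ψ (frameGen d n q j)) : φ = ψ := by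
  have units_eq : ((φ : YH d n q →* A).comp (ofModular d n q)).toHomUnits =
      ((ψ : YH d n q →* A).comp (ofModular d n q)).toHomUnits := by
    refine PresentedGroup.ext fun x => Units.ext ?_
    cases x with
    | σ i hi => simpa [braidGen_eq hi, g, mσ] using hg i hi
    | t j => simpa [frameGen_eq j.2, t, mt] using ht j j.2
  refine RingQuot.ringQuot_ext' _ _ _
    (MonoidAlgebra.algHom_ext (fun x => ?_) (Subsingleton.elim _ _))
  exact congrArg Units.val (DFunLike.congr_fun units_eq x)

theorem eq_top_of_generators_mem [NeZero d] {S : Subalgebra ℂ (YH d n q)}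
    (hg : ∀ i, i + 1 < n → braidGen d n q i ∈ S) (ht : ∀ j, j < n → frameGen d n q j ∈ S) :
    S = ⊤ := by
  let g' (i : ℕ) : S := if hi : i + 1 < n then ⟨braidGen d n q i, hg i hi⟩ else 1
  let t' (j : ℕ) : S := if hj : j < n then ⟨frameGen d n q j, ht j hj⟩ else 1
  have val_g' : S.val ∘ g' = braidGen d n q := by
    ext i; by_cases hi : i + 1 < n <;> simp [g', braidGen, hi]
  have val_t' : S.val ∘ t' = frameGen d n q := by
    ext j; by_cases hj : j < n <;> simp [t', frameGen, hj]
  have h : YHFamily d n q g' t' := YHFamily.of_injective (φ := S.val) Subtype.val_injective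
    (by rw [val_g', val_t']; exact yhFamily_generators d n q)
  have val_lift : S.val.comp h.lift = AlgHom.id ℂ (YH d n q) :=
    algHom_ext (fun i hi => by simpa [h.lift_braidGen hi] using congrFun val_g' i)
      (fun j hj => by simpa [h.lift_frameGen hj] using congrFun val_t' j)
  refine eq_top_iff.mpr fun y _ => ?_
  rw [← AlgHom.id_apply (R := ℂ) y, ← val_lift]
  exact (h.lift y).2

theorem algHom_intertwine [NeZero d] {V W : Type*} [AddCommGroup V] [Module ℂ V]
    [AddCommGroup W] [Module ℂ W] {ρ : YH d n q →ₐ[ℂ] Module.End ℂ V}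
    {σ : YH d n q →ₐ[ℂ] Module.End ℂ W} {L : V →ₗ[ℂ] W}
    (hg : ∀ i, i + 1 < n → ∀ v, L (ρ (braidGen d n q i) v) = σ (braidGen d n q i) (L v))
    (ht : ∀ j, j < n → ∀ v, L (ρ (frameGen d n q j) v) = σ (frameGen d n q j) (L v))
    (y : YH d n q) (v : V) : L (ρ y v) = σ y (L v) := by
  let S : Subalgebra ℂ (YH d n q) :=
    { carrier := {y | ∀ v, L (ρ y v) = σ y (L v)}
      mul_mem' := fun hx hy v => by simp only [map_mul, Module.End.mul_apply, hx _, hy _]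
      add_mem' := fun hx hy v => by simp only [map_add, LinearMap.add_apply, hx v, hy v]
      algebraMap_mem' := fun c v => by
        simp only [AlgHom.commutes, Module.algebraMap_end_apply, map_smul] }
  have hy : y ∈ S := eq_top_of_generators_mem (S := S) hg ht ▸ Algebra.mem_top
  exact hy v

theorem commute_algHom [NeZero d] {A : Type*} [Ring A] [Algebra ℂ A] {φ : YH d n q →ₐ[ℂ] A}
    {x : A} (hg : ∀ i, i + 1 < n → Commute x (φ (braidGen d n q i)))
    (ht : ∀ j, j < n → Commute x (φ (frameGen d n q j))) (y : YH d n q) : Commute x (φ y) := by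
  have mem_centralizer (z : A) : z ∈ Subalgebra.centralizer ℂ {x} ↔ Commute x z := by
    simp [Subalgebra.mem_centralizer_iff, commute_iff_eq]
  have comap_eq_top : (Subalgebra.centralizer ℂ {x}).comap φ = ⊤ :=
    eq_top_of_generators_mem (fun i hi => (mem_centralizer _).mpr (hg i hi))
      (fun j hj => (mem_centralizer _).mpr (ht j hj))
  exact (mem_centralizer _).mp (comap_eq_top.ge (Algebra.mem_top (x := y)))

theorem incl_ofModular (x : ModularFramedBraidGroup d n) :
    incl d n q (ofModular d n q x) = ofModular d (n + 1) q (modularIncl d n x) := by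
  simp [incl, ofModular, MonoidAlgebra.lift_of, -MonoidAlgebra.of_apply]

theorem incl_braidGen {i : ℕ} (hi : i + 1 < n) :
    incl d n q (braidGen d n q i) = braidGen d (n + 1) q i := by
  rw [braidGen_eq hi, braidGen_eq (by omega), g, incl_ofModular]
  exact congrArg _ (liftRel_of _ _ _)

theorem incl_frameGen {j : ℕ} (hj : j < n) :
    incl d n q (frameGen d n q j) = frameGen d (n + 1) q j := by
  rw [frameGen_eq hj, frameGen_eq (by omega), t, incl_ofModular]
  exact congrArg _ (liftRel_of _ _ _)

end generators

/-! ### The coset representation -/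

/-- The sequence `t` with `τ` inserted at position `k`: the framing of the last strand when that
strand has been moved to position `k`. -/
def insertFrame {F : Type*} (τ : F) (t : ℕ → F) (k j : ℕ) : F :=
  if j < k then t j else if j = k then τ else t (j - 1)

section insertFrame

variable {F : Type*} {τ : F} {t : ℕ → F}

theorem insertFrame_lt {j k : ℕ} (h : j < k) : insertFrame τ t k j = t j := if_pos h

theorem insertFrame_self (k : ℕ) : insertFrame τ t k k = τ := by simp [insertFrame]

theorem insertFrame_succ {j k : ℕ} (h : k ≤ j) : insertFrame τ t k (j + 1) = t j := by
  simp [insertFrame, show ¬ j + 1 < k by omega, show j + 1 ≠ k by omega]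

theorem insertFrame_cases {n j k : ℕ} (hj : j < n + 1) (hk : k < n + 1) :
    insertFrame τ t k j = τ ∨ ∃ m < n, insertFrame τ t k j = t m := by
  rcases lt_trichotomy j k with hjk | rfl | hjk
  · exact Or.inr ⟨j, by omega, insertFrame_lt hjk⟩
  · exact Or.inl (insertFrame_self j)
  · obtain ⟨j, rfl⟩ := Nat.exists_eq_add_one.mpr (Nat.zero_lt_of_lt hjk)
    exact Or.inr ⟨j, by omega, insertFrame_succ (by omega)⟩

theorem insertFrame_succ_swap (i j : ℕ) :
    insertFrame τ t (i + 1) (Equiv.swap i (i + 1) j) = insertFrame τ t i j := by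
  rcases eq_or_ne j i with rfl | hji
  · rw [Equiv.swap_apply_left, insertFrame_self, insertFrame_self]
  rcases eq_or_ne j (i + 1) with rfl | hji'
  · rw [Equiv.swap_apply_right, insertFrame_lt (by omega), insertFrame_succ le_rfl]
  rw [Equiv.swap_apply_of_ne_of_ne hji hji']
  rcases lt_or_gt_of_ne hji with hlt | hgt
  · rw [insertFrame_lt hlt, insertFrame_lt (by omega)]
  · obtain ⟨j, rfl⟩ := Nat.exists_eq_add_one.mpr (Nat.zero_lt_of_lt hgt)
    rw [insertFrame_succ (by omega), insertFrame_succ (by omega)]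

end insertFrame

section coset

variable {F : Type*} [Ring F] [Algebra ℂ F] (d n : ℕ) (q : ℂ) (τ : F) (g t : ℕ → F)

/-- The action of `t_j` on the module `F^{n+1}`, whose `k`-th summand stands for the coset
`g_k ⋯ g_{n-1} F`. -/
def cosetT (j : ℕ) : Module.End ℂ (Fin (n + 1) → F) :=
  Algebra.lmul ℂ (Fin (n + 1) → F) fun k => insertFrame τ t k j

/-- The action of `g_i` on the module `F^{n+1}`, whose `k`-th summand stands for the coset
`g_k ⋯ g_{n-1} F`. -/
def cosetG (i : ℕ) : Module.End ℂ (Fin (n + 1) → F) where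
  toFun f k :=
    if (k : ℕ) < i then g (i - 1) * f k
    else if (k : ℕ) = i then
      f (Fin.ofNat (n + 1) (i + 1)) + (q - q⁻¹) • (frameAvg d τ (t i) * f k)
    else if (k : ℕ) = i + 1 then f (Fin.ofNat (n + 1) i)
    else g i * f k
  map_add' f f' := by
    ext1 k
    simp only [Pi.add_apply]
    split_ifs <;> simp only [mul_add, smul_add, add_add_add_comm]
  map_smul' r f := by
    ext1 k
    simp only [Pi.smul_apply, RingHom.id_apply]
    split_ifs <;> simp only [mul_smul_comm, smul_add, smul_comm r]

variable {d n q τ g t}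

theorem cosetT_apply (j : ℕ) (f : Fin (n + 1) → F) (k : Fin (n + 1)) :
    cosetT n τ t j f k = insertFrame τ t k j * f k := rfl

theorem cosetG_lt {i k : ℕ} (hk : k < n + 1) (hki : k < i + 1) (f : Fin (n + 1) → F) :
    cosetG d n q τ g t (i + 1) f ⟨k, hk⟩ = g i * f ⟨k, hk⟩ :=
  if_pos hki

theorem cosetG_self {i : ℕ} (hi : i < n + 1) (hi' : i + 1 < n + 1) (f : Fin (n + 1) → F) :
    cosetG d n q τ g t i f ⟨i, hi⟩ =
      f ⟨i + 1, hi'⟩ + (q - q⁻¹) • (frameAvg d τ (t i) * f ⟨i, hi⟩) := by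
  simp [cosetG, -Fin.ofNat_eq_cast,
    show Fin.ofNat (n + 1) (i + 1) = ⟨i + 1, hi'⟩ from Fin.ext (Nat.mod_eq_of_lt hi')]

theorem cosetG_succ {i : ℕ} (hi : i + 1 < n + 1) (f : Fin (n + 1) → F) :
    cosetG d n q τ g t i f ⟨i + 1, hi⟩ = f ⟨i, by omega⟩ := by
  have hi' : i < n + 1 := by omega
  simp [cosetG, -Fin.ofNat_eq_cast,
    show Fin.ofNat (n + 1) i = ⟨i, hi'⟩ from Fin.ext (Nat.mod_eq_of_lt hi')]

theorem cosetG_gt {i k : ℕ} (hk : k < n + 1) (hik : i + 1 < k) (f : Fin (n + 1) → F) :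
    cosetG d n q τ g t i f ⟨k, hk⟩ = g i * f ⟨k, hk⟩ := by
  simp [cosetG, show ¬ k < i by omega, show k ≠ i by omega, show k ≠ i + 1 by omega]

theorem frameAvg_cosetT_apply (i j : ℕ) (f : Fin (n + 1) → F) (k : Fin (n + 1)) :
    frameAvg d (cosetT n τ t i) (cosetT n τ t j) f k =
      frameAvg d (insertFrame τ t k i) (insertFrame τ t k j) * f k := by
  rw [cosetT, cosetT, ← map_frameAvg]
  exact congrArg (· * f k) (map_frameAvg (Pi.evalAlgHom ℂ (fun _ : Fin (n + 1) => F) k) _ _)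

namespace YHFamily

theorem map {A : Type*} [Ring A] [Algebra ℂ A] {g t : ℕ → A} (h : YHFamily d n q g t)
    (φ : A →ₐ[ℂ] F) : YHFamily d n q (φ ∘ g) (φ ∘ t) where
  braid i hi := by simpa using congrArg φ (h.braid i hi)
  far i j hij hj := (h.far i j hij hj).map φ
  t_comm i j hi hj := (h.t_comm i j hi hj).map φ
  t_mul_g i j hi hj := by simpa using congrArg φ (h.t_mul_g i j hi hj)
  t_pow j hj := by simpa using congrArg φ (h.t_pow j hj)
  quad i hi := by simpa [map_frameAvg] using congrArg φ (h.quad i hi)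

variable (h : YHFamily d n q g t)
include h

theorem insertFrame_commute (hτ : ∀ x, Commute τ x) {i j k : ℕ} (hi : i < n + 1)
    (hj : j < n + 1) (hk : k < n + 1) :
    Commute (insertFrame τ t k i) (insertFrame τ t k j) := by
  rcases insertFrame_cases (τ := τ) (t := t) hi hk with hi' | ⟨m, hm, hi'⟩
  · rw [hi']; exact hτ _
  rcases insertFrame_cases (τ := τ) (t := t) hj hk with hj' | ⟨m', hm', hj'⟩
  · rw [hj']; exact (hτ _).symm
  · rw [hi', hj']; exact h.t_comm m m' hm hm'

theorem insertFrame_pow (hτd : τ ^ d = 1) {j k : ℕ} (hj : j < n + 1) (hk : k < n + 1) :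
    insertFrame τ t k j ^ d = 1 := by
  rcases insertFrame_cases (τ := τ) (t := t) hj hk with hj' | ⟨m, hm, hj'⟩
  · rw [hj', hτd]
  · rw [hj', h.t_pow m hm]

theorem insertFrame_mul_g_left (hτ : ∀ x, Commute τ x) {i j k : ℕ} (hi : i + 1 < n)
    (hj : j < n + 1) (hki : k ≤ i) :
    insertFrame τ t k j * g i =
      g i * insertFrame τ t k (Equiv.swap (i + 1) (i + 1 + 1) j) := by
  rcases eq_or_ne j (i + 1) with rfl | hji
  · rw [Equiv.swap_apply_left, insertFrame_succ hki, insertFrame_succ (by omega),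
      h.t_mul_g_self hi]
  rcases eq_or_ne j (i + 1 + 1) with rfl | hji'
  · rw [Equiv.swap_apply_right, insertFrame_succ hki, insertFrame_succ (by omega),
      h.t_mul_g_succ hi]
  rw [Equiv.swap_apply_of_ne_of_ne hji hji']
  rcases lt_trichotomy j k with hjk | rfl | hjk
  · rw [insertFrame_lt hjk, h.commute_t_g hi (by omega) (by omega) (by omega)]
  · rw [insertFrame_self, hτ]
  · obtain ⟨j, rfl⟩ := Nat.exists_eq_add_one.mpr (Nat.zero_lt_of_lt hjk)
    rw [insertFrame_succ (by omega), h.commute_t_g hi (by omega) (by omega) (by omega)]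

theorem insertFrame_mul_g_right (hτ : ∀ x, Commute τ x) {i j k : ℕ} (hj : j < n + 1)
    (hk : k < n + 1) (hik : i + 1 < k) :
    insertFrame τ t k j * g i = g i * insertFrame τ t k (Equiv.swap i (i + 1) j) := by
  rcases eq_or_ne j i with rfl | hji
  · rw [Equiv.swap_apply_left, insertFrame_lt hik, insertFrame_lt (by omega),
      h.t_mul_g_self (by omega)]
  rcases eq_or_ne j (i + 1) with rfl | hji'
  · rw [Equiv.swap_apply_right, insertFrame_lt hik, insertFrame_lt (by omega),
      h.t_mul_g_succ (by omega)]
  rw [Equiv.swap_apply_of_ne_of_ne hji hji']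
  rcases lt_trichotomy j k with hjk | rfl | hjk
  · rw [insertFrame_lt hjk, h.commute_t_g (by omega) (by omega) (by omega) (by omega)]
  · rw [insertFrame_self, hτ]
  · obtain ⟨j, rfl⟩ := Nat.exists_eq_add_one.mpr (Nat.zero_lt_of_lt hjk)
    rw [insertFrame_succ (by omega), h.commute_t_g (by omega) (by omega) (by omega) (by omega)]

theorem insertFrame_mul_frameAvg (hτ : ∀ x, Commute τ x) (hτd : τ ^ d = 1) {i j : ℕ}
    (hi : i < n) (hj : j < n + 1) :
    insertFrame τ t i j * frameAvg d τ (t i) =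
      frameAvg d τ (t i) * insertFrame τ t i (Equiv.swap i (i + 1) j) := by
  have absorb := mul_frameAvg_absorb (hτ (t i)) hτd (h.t_pow i hi)
  have commute_t (m : ℕ) (hm : m < n) : Commute (t m) (frameAvg d τ (t i)) :=
    semiconjBy_frameAvg (hτ _).symm (h.t_comm m i hm hi)
  rcases eq_or_ne j i with rfl | hji
  · rw [Equiv.swap_apply_left, insertFrame_self, insertFrame_succ le_rfl, absorb,
      (commute_t j hi).eq]
  rcases eq_or_ne j (i + 1) with rfl | hji'
  · rw [Equiv.swap_apply_right, insertFrame_self, insertFrame_succ le_rfl, ← absorb, (hτ _).eq]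
  rw [Equiv.swap_apply_of_ne_of_ne hji hji']
  rcases insertFrame_cases (τ := τ) (t := t) hj (show i < n + 1 by omega) with hj' | ⟨m, hm, hj'⟩
  · rw [hj', (hτ _).eq]
  · rw [hj', (commute_t m hm).eq]

theorem cosetT_mul_cosetG (hτ : ∀ x, Commute τ x) (hτd : τ ^ d = 1) {i j : ℕ} (hi : i < n)
    (hj : j < n + 1) :
    cosetT n τ t j * cosetG d n q τ g t i =
      cosetG d n q τ g t i * cosetT n τ t (Equiv.swap i (i + 1) j) := by
  refine LinearMap.ext fun f => funext fun ⟨k, hk⟩ => ?_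
  simp only [Module.End.mul_apply, cosetT_apply]
  rcases lt_trichotomy k i with hki | rfl | hki
  · obtain ⟨i, rfl⟩ := Nat.exists_eq_add_one.mpr (Nat.zero_lt_of_lt hki)
    rw [cosetG_lt hk hki, cosetG_lt hk hki, cosetT_apply, ← mul_assoc,
      h.insertFrame_mul_g_left hτ hi hj (by omega), mul_assoc]
  · rw [cosetG_self hk (by omega), cosetG_self hk (by omega), cosetT_apply, cosetT_apply,
      insertFrame_succ_swap, mul_add, mul_smul_comm, ← mul_assoc, ← mul_assoc,
      h.insertFrame_mul_frameAvg hτ hτd hi hj]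
  rcases (show i + 1 ≤ k by omega).eq_or_lt with rfl | hki
  · rw [cosetG_succ hk, cosetG_succ hk, cosetT_apply, ← insertFrame_succ_swap i (Equiv.swap _ _ _),
      Equiv.swap_apply_self]
  · rw [cosetG_gt hk hki, cosetG_gt hk hki, cosetT_apply, ← mul_assoc,
      h.insertFrame_mul_g_right hτ hj hk hki, mul_assoc]

theorem g_mul_frameAvg (hτ : ∀ x, Commute τ x) {i : ℕ} (hi : i + 1 < n) :
    g i * frameAvg d τ (t i) = frameAvg d τ (t (i + 1)) * g i :=
  semiconjBy_frameAvg (hτ _).symm (h.t_mul_g_succ hi).symm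

theorem g_mul_frameAvg_succ (hτ : ∀ x, Commute τ x) {i : ℕ} (hi : i + 1 < n) :
    g i * frameAvg d τ (t (i + 1)) = frameAvg d τ (t i) * g i :=
  semiconjBy_frameAvg (hτ _).symm (h.t_mul_g_self hi).symm

theorem commute_g_frameAvg_of_far (hτ : ∀ x, Commute τ x) {i j : ℕ} (hi : i + 1 < n) (hj : j < n)
    (hji : j ≠ i) (hji' : j ≠ i + 1) : Commute (g i) (frameAvg d τ (t j)) :=
  semiconjBy_frameAvg (hτ _).symm (h.commute_t_g hi hj hji hji').symm

theorem g_mul_frameAvg_mul_g (hτ : ∀ x, Commute τ x) (hτd : τ ^ d = 1) {i : ℕ} (hi : i + 1 < n) :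
    g i * frameAvg d τ (t i) * g i = frameAvg d τ (t (i + 1)) +
      (q - q⁻¹) • (frameAvg d τ (t i) * g i * frameAvg d τ (t i)) := by
  have ti_pow := h.t_pow i (by omega)
  have avg_mul_avg : frameAvg d τ (t (i + 1)) * frameAvg d τ (t i) =
      frameAvg d (t i) (t (i + 1)) * frameAvg d τ (t i) := by
    rw [frameAvg_comm (hτ (t i)) hτd ti_pow]
    exact frameAvg_mul_frameAvg (hτ _).symm (h.t_comm _ _ (by omega) hi) (hτ _) ti_pow hτd
  calc g i * frameAvg d τ (t i) * g i
      = g i * g i * frameAvg d τ (t (i + 1)) := by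
        rw [mul_assoc, ← h.g_mul_frameAvg_succ hτ hi, ← mul_assoc]
    _ = frameAvg d τ (t (i + 1)) +
          (q - q⁻¹) • (frameAvg d (t i) (t (i + 1)) * frameAvg d τ (t i) * g i) := by
        rw [h.quad i hi, add_mul, one_mul, smul_mul_assoc, mul_assoc, h.g_mul_frameAvg_succ hτ hi,
          mul_assoc]
    _ = _ := by
        have commute_avg : Commute (frameAvg d τ (t (i + 1))) (frameAvg d τ (t i)) :=
          semiconjBy_frameAvg (hτ _).symm
            (semiconjBy_frameAvg (hτ _).symm (h.t_comm i (i + 1) (by omega) hi)).symm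
        rw [← avg_mul_avg, commute_avg.eq, mul_assoc, mul_assoc, h.g_mul_frameAvg hτ hi]

theorem cosetG_braid (hτ : ∀ x, Commute τ x) (hτd : τ ^ d = 1) {i : ℕ} (hi : i + 1 < n) :
    cosetG d n q τ g t i * cosetG d n q τ g t (i + 1) * cosetG d n q τ g t i =
      cosetG d n q τ g t (i + 1) * cosetG d n q τ g t i * cosetG d n q τ g t (i + 1) := by
  refine LinearMap.ext fun f => funext fun ⟨k, hk⟩ => ?_
  simp only [Module.End.mul_apply]
  rcases lt_trichotomy k i with hki | rfl | hki
  · obtain ⟨i, rfl⟩ := Nat.exists_eq_add_one.mpr (Nat.zero_lt_of_lt hki)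
    simp (disch := omega) only [cosetG_lt, ← mul_assoc, h.braid i hi]
  · simp (disch := omega) only [cosetG_lt, cosetG_self, cosetG_succ, cosetG_gt, mul_add,
      smul_add, mul_smul_comm, ← mul_assoc, h.g_mul_frameAvg_mul_g hτ hτd hi,
      h.g_mul_frameAvg_succ hτ hi, add_mul, smul_mul_assoc]
    abel
  rcases (show i + 1 ≤ k by omega).eq_or_lt with rfl | hki
  · simp (disch := omega) only [cosetG_lt, cosetG_self, cosetG_succ, cosetG_gt, mul_add,
      mul_smul_comm, ← mul_assoc, h.g_mul_frameAvg hτ hi]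
  rcases (show i + 1 + 1 ≤ k by omega).eq_or_lt with rfl | hki
  · simp (disch := omega) only [cosetG_lt, cosetG_succ, cosetG_gt]
  · simp (disch := omega) only [cosetG_gt, ← mul_assoc, h.braid i (by omega)]

theorem commute_cosetG (hτ : ∀ x, Commute τ x) {i j : ℕ} (hij : i < j) (hj : j + 1 < n) :
    Commute (cosetG d n q τ g t i) (cosetG d n q τ g t (j + 1)) := by
  refine LinearMap.ext fun f => funext fun ⟨k, hk⟩ => ?_
  simp only [Module.End.mul_apply]
  rcases lt_trichotomy k i with hki | rfl | hki
  · obtain ⟨i, rfl⟩ := Nat.exists_eq_add_one.mpr (Nat.zero_lt_of_lt hki)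
    simp (disch := omega) only [cosetG_lt, ← mul_assoc, (h.far i j hij hj).eq]
  · simp (disch := omega) only [cosetG_lt, cosetG_self, mul_add, mul_smul_comm, ← mul_assoc,
      (h.commute_g_frameAvg_of_far hτ (i := j) (j := k) hj (by omega) (by omega) (by omega)).eq]
  rcases (show i + 1 ≤ k by omega).eq_or_lt with rfl | hki
  · simp (disch := omega) only [cosetG_lt, cosetG_succ]
  rcases lt_trichotomy k (j + 1) with hkj | rfl | hkj
  · simp (disch := omega) only [cosetG_lt, cosetG_gt, ← mul_assoc,
      (h.far i j (by omega) hj).eq]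
  · simp (disch := omega) only [cosetG_gt, cosetG_self, mul_add, mul_smul_comm, ← mul_assoc,
      (h.commute_g_frameAvg_of_far hτ (i := i) (j := j + 1) (by omega) hj (by omega)
        (by omega)).eq]
  rcases (show j + 1 + 1 ≤ k by omega).eq_or_lt with rfl | hkj
  · simp (disch := omega) only [cosetG_gt, cosetG_succ]
  · simp (disch := omega) only [cosetG_gt, ← mul_assoc, (h.far i (j + 1) (by omega) (by omega)).eq]

theorem cosetG_mul_cosetG (hτ : ∀ x, Commute τ x) (hτd : τ ^ d = 1) {i : ℕ} (hi : i < n) :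
    cosetG d n q τ g t i * cosetG d n q τ g t i = 1 + (q - q⁻¹) •
      (frameAvg d (cosetT n τ t i) (cosetT n τ t (i + 1)) * cosetG d n q τ g t i) := by
  refine LinearMap.ext fun f => funext fun ⟨k, hk⟩ => ?_
  simp only [Module.End.mul_apply, LinearMap.add_apply, Module.End.one_apply,
    LinearMap.smul_apply, Pi.add_apply, Pi.smul_apply, frameAvg_cosetT_apply]
  rcases lt_trichotomy k i with hki | rfl | hki
  · obtain ⟨i, rfl⟩ := Nat.exists_eq_add_one.mpr (Nat.zero_lt_of_lt hki)
    simp (disch := omega) only [cosetG_lt, insertFrame_succ]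
    rw [← mul_assoc, h.quad i hi, add_mul, one_mul, smul_mul_assoc, mul_assoc]
  · rw [insertFrame_self, insertFrame_succ le_rfl, cosetG_self hk (by omega), cosetG_succ]
  rcases (show i + 1 ≤ k by omega).eq_or_lt with rfl | hki
  · rw [insertFrame_self, insertFrame_lt (by omega), cosetG_succ, cosetG_self (by omega) hk,
      cosetG_succ, frameAvg_comm (hτ _) hτd (h.t_pow i hi)]
  · simp (disch := omega) only [cosetG_gt, insertFrame_lt]
    rw [← mul_assoc, h.quad i (by omega), add_mul, one_mul, smul_mul_assoc, mul_assoc]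

theorem coset (hτ : ∀ x, Commute τ x) (hτd : τ ^ d = 1) :
    YHFamily d (n + 1) q (cosetG d n q τ g t) (cosetT n τ t) where
  braid i hi := h.cosetG_braid hτ hτd (by omega)
  far i j hij hj := by
    obtain ⟨j, rfl⟩ := Nat.exists_eq_add_one.mpr (Nat.zero_lt_of_lt hij)
    exact h.commute_cosetG hτ (by omega) (by omega)
  t_comm i j hi hj :=
    (show Commute (S := Fin (n + 1) → F) _ _ from
      funext fun k => h.insertFrame_commute hτ hi hj k.2).map (Algebra.lmul ℂ (Fin (n + 1) → F))
  t_mul_g i j hi hj := h.cosetT_mul_cosetG hτ hτd (by omega) hj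
  t_pow j hj := by
    rw [cosetT, ← map_pow, ← map_one (Algebra.lmul ℂ (Fin (n + 1) → F))]
    exact congrArg _ (funext fun k => h.insertFrame_pow hτd hj k.2)
  quad i hi := h.cosetG_mul_cosetG hτ hτd (by omega)

end YHFamily

end coset

/-! ### Coefficients in the coset module -/

/-- The product `g k * g (k + 1) * ⋯ * g (k + m - 1)`. -/
def tailProd {M : Type*} [Monoid M] (g : ℕ → M) : ℕ → ℕ → M
  | _, 0 => 1
  | k, m + 1 => g k * tailProd g (k + 1) m

namespace YHFamily

variable {d n : ℕ} {q : ℂ} {A : Type*} [Ring A] [Algebra ℂ A] {g t : ℕ → A}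
  (h : YHFamily d n q g t)
include h

theorem t_mul_tailProd {k m : ℕ} (hk : k + m < n) :
    t k * tailProd g k m = tailProd g k m * t (k + m) := by
  induction m generalizing k with
  | zero => simp [tailProd]
  | succ m ih =>
    rw [tailProd, ← mul_assoc, h.t_mul_g_self (by omega), mul_assoc, ih (by omega), mul_assoc,
      show k + 1 + m = k + (m + 1) by omega]

theorem commute_t_tailProd {j k m : ℕ} (hk : k + m < n) (hj : j < k) :
    Commute (t j) (tailProd g k m) := by
  induction m generalizing k with
  | zero => exact Commute.one_right _
  | succ m ih =>
    exact (h.commute_t_g (by omega) (by omega) (by omega) (by omega)).mul_right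
      (ih (by omega) (by omega))

theorem t_succ_mul_tailProd {j k m : ℕ} (hk : k + m < n) (hj : k ≤ j) (hj' : j < k + m) :
    t (j + 1) * tailProd g k m = tailProd g k m * t j := by
  induction m generalizing k with
  | zero => omega
  | succ m ih =>
    rw [tailProd, ← mul_assoc]
    rcases hj.eq_or_lt with rfl | hj
    · rw [h.t_mul_g_succ (by omega), mul_assoc, (h.commute_t_tailProd (by omega) (by omega)).eq,
        mul_assoc]
    · rw [(h.commute_t_g (by omega) (by omega) (by omega) (by omega)).eq, mul_assoc,
        ih (by omega) (by omega) (by omega), mul_assoc]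

theorem commute_g_tailProd {i k m : ℕ} (hk : k + m < n) (hi : i + 1 < k) :
    Commute (g i) (tailProd g k m) := by
  induction m generalizing k with
  | zero => exact Commute.one_right _
  | succ m ih => exact (h.far i k hi (by omega)).mul_right (ih (by omega) (by omega))

theorem g_succ_mul_tailProd {i k m : ℕ} (hk : k + m < n) (hi : k ≤ i) (hi' : i + 1 < k + m) :
    g (i + 1) * tailProd g k m = tailProd g k m * g i := by
  induction m generalizing k with
  | zero => omega
  | succ m ih =>
    rcases hi.eq_or_lt with rfl | hi
    · obtain ⟨m, rfl⟩ : ∃ m', m = m' + 1 := Nat.exists_eq_add_one.mpr (by omega)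
      simp only [tailProd]
      rw [← mul_assoc, ← mul_assoc, ← h.braid k (by omega), mul_assoc,
        (h.commute_g_tailProd (by omega) (by omega)).eq]
      simp only [mul_assoc]
    · rw [tailProd, ← mul_assoc, ← (h.far k (i + 1) (by omega) (by omega)).eq, mul_assoc,
        ih (by omega) (by omega) (by omega), mul_assoc]

theorem g_mul_tailProd_succ {i m : ℕ} (hi : i + (m + 1) < n) :
    g i * tailProd g i (m + 1) = tailProd g (i + 1) m +
      (q - q⁻¹) • (frameAvg d (t i) (t (i + 1)) * tailProd g i (m + 1)) := by
  rw [tailProd, ← mul_assoc, h.quad i (by omega), add_mul, one_mul, smul_mul_assoc, mul_assoc]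

theorem tailProd_mul_frameAvg {i m : ℕ} (hi : i + (m + 1) < n) :
    tailProd g i (m + 1) * frameAvg d (t (i + (m + 1))) (t i) =
      frameAvg d (t i) (t (i + 1)) * tailProd g i (m + 1) :=
  semiconjBy_frameAvg (h.t_mul_tailProd hi).symm
    (h.t_succ_mul_tailProd hi le_rfl (by omega)).symm

end YHFamily

/-- The algebra `A[τ]/(τ^d - 1)`, in which `τ` is the framing of an additional strand. -/
abbrev Frame (d : ℕ) (A : Type*) [Ring A] : Type _ := AddMonoidAlgebra A (ZMod d)

section Frame

variable {d : ℕ} {A : Type*} [Ring A]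

variable (d) in
/-- The generator `τ` of `Frame d A`. -/
def frameVar : Frame d A := AddMonoidAlgebra.single 1 1

theorem commute_frameVar (b : Frame d A) : Commute (frameVar d) b :=
  AddMonoidAlgebra.single_commute (fun _ => add_comm _ _) (fun _ => Commute.one_left _) b

theorem frameVar_pow (s : ℕ) :
    (frameVar d : Frame d A) ^ s = AddMonoidAlgebra.single (s : ZMod d) (1 : A) := by
  simp [frameVar, AddMonoidAlgebra.single_pow]

theorem frameVar_pow_self : (frameVar d : Frame d A) ^ d = 1 := by
  rw [frameVar_pow, ZMod.natCast_self, AddMonoidAlgebra.one_def]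

variable [Algebra ℂ A]

variable (d) in
/-- The inclusion of the constants `A → Frame d A`. -/
def frameConst : A →ₐ[ℂ] Frame d A := AddMonoidAlgebra.singleZeroAlgHom

theorem coeff_frameConst_mul (a : A) (b : Frame d A) (s : ZMod d) :
    (frameConst d a * b).coeff s = a * b.coeff s :=
  AddMonoidAlgebra.coeff_single_zero_mul b a s

theorem coeff_mul_frameConst (a : A) (b : Frame d A) (s : ZMod d) :
    (b * frameConst d a).coeff s = b.coeff s * a :=
  AddMonoidAlgebra.coeff_mul_single_zero b a s

variable [NeZero d]

variable (d) in
/-- The evaluation of `∑ s, τ ^ s * a s` at `τ = x`, with `x` on the left: `x` need not commute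
with the coefficients. -/
def frameEval (x : A) : Frame d A →ₗ[ℂ] A where
  toFun b := ∑ k : ZMod d, x ^ k.val * b.coeff k
  map_add' b b' := by simp [mul_add, Finset.sum_add_distrib]
  map_smul' c b := by simp [Finset.smul_sum]

theorem frameEval_apply (x : A) (b : Frame d A) :
    frameEval d x b = ∑ k : ZMod d, x ^ k.val * b.coeff k := rfl

theorem frameEval_one (x : A) : frameEval d x 1 = 1 := by
  simp [frameEval_apply, AddMonoidAlgebra.one_def, Finsupp.single_apply]

theorem frameEval_const_mul {x a : A} (h : Commute a x) (b : Frame d A) :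
    frameEval d x (frameConst d a * b) = a * frameEval d x b := by
  simp only [frameEval_apply, coeff_frameConst_mul, Finset.mul_sum, ← mul_assoc,
    (h.pow_right _).eq]

theorem frameEval_mul_const (x a : A) (b : Frame d A) :
    frameEval d x (b * frameConst d a) = frameEval d x b * a := by
  simp only [frameEval_apply, coeff_mul_frameConst, Finset.sum_mul, mul_assoc]

theorem frameEval_var_mul {x : A} (h : x ^ d = 1) (b : Frame d A) :
    frameEval d x (frameVar d * b) = x * frameEval d x b := by
  simp only [frameEval_apply, Finset.mul_sum, ← mul_assoc, ← pow_succ']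
  refine (Fintype.sum_equiv (Equiv.addLeft 1) _ _ fun k => ?_).symm
  have coeff_eq : (frameVar d * b).coeff (1 + k) = b.coeff k := by simp [frameVar]
  have pow_eq : x ^ (1 + k).val = x ^ (k.val + 1) := by
    rw [ZMod.val_add, ← pow_eq_pow_mod _ h, pow_add, ZMod.val_one_eq_one_mod,
      ← pow_eq_pow_mod _ h, pow_one, pow_succ']
  rw [Equiv.coe_addLeft, coeff_eq, pow_eq]

end Frame

theorem sum_eq_sum_of_eq_off_pair {ι M : Type*} [Fintype ι] [AddCommMonoid M]
    {a b : ι} (hab : a ≠ b) {x y : ι → M} (h : ∀ k, k ≠ a → k ≠ b → x k = y k)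
    (h' : x a + x b = y a + y b) : ∑ k, x k = ∑ k, y k := by
  classical
  rw [← Finset.sum_add_sum_compl {a, b}, ← Finset.sum_add_sum_compl {a, b} y,
    Finset.sum_pair hab, Finset.sum_pair hab, h']
  congr 1
  refine Finset.sum_congr rfl fun k hk => ?_
  simp only [Finset.mem_compl, Finset.mem_insert, Finset.mem_singleton, not_or] at hk
  exact h k hk.1 hk.2

section cosetMulRight

variable {F : Type*} [Ring F] [Algebra ℂ F] {d n : ℕ} {q : ℂ} {τ : F} {g t : ℕ → F}

theorem cosetT_mul_right (j : ℕ) (f c : Fin (n + 1) → F) :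
    cosetT n τ t j (f * c) = cosetT n τ t j f * c :=
  (mul_assoc _ _ _).symm

theorem cosetG_mul_right (i : ℕ) (f : Fin (n + 1) → F) (c : F) :
    cosetG d n q τ g t i (f * fun _ => c) = cosetG d n q τ g t i f * fun _ => c := by
  funext k
  simp only [cosetG, LinearMap.coe_mk, AddHom.coe_mk, Pi.mul_apply]
  split_ifs <;> simp only [add_mul, smul_mul_assoc, mul_assoc]

end cosetMulRight

section projections

variable {d n : ℕ} {q : ℂ} {A : Type*} [Ring A] [Algebra ℂ A] {g t : ℕ → A}

variable (n) in
/-- The projection of the coset module to the coefficient of `τ ^ s` in the summand of the trivial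
coset. -/
def cosetFrameCoeff (s : ZMod d) : (Fin (n + 1) → Frame d A) →ₗ[ℂ] A :=
  Finsupp.lapply s ∘ₗ (AddMonoidAlgebra.coeffLinearEquiv ℂ).toLinearMap ∘ₗ
    LinearMap.proj (Fin.last n)

theorem cosetFrameCoeff_apply (s : ZMod d) (f : Fin (n + 1) → Frame d A) :
    cosetFrameCoeff n s f = (f (Fin.last n)).coeff s := rfl

theorem cosetFrameCoeff_mul_const (s : ZMod d) (f : Fin (n + 1) → Frame d A) (a : A) :
    cosetFrameCoeff n s (f * fun _ => frameConst d a) = cosetFrameCoeff n s f * a :=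
  coeff_mul_frameConst a (f (Fin.last n)) s

theorem cosetFrameCoeff_cosetT (s : ZMod d) {j : ℕ} (hj : j < n) (f : Fin (n + 1) → Frame d A) :
    cosetFrameCoeff n s (cosetT n (frameVar d) (frameConst d ∘ t) j f) =
      t j * cosetFrameCoeff n s f := by
  rw [cosetFrameCoeff_apply, cosetT_apply, Fin.val_last, insertFrame_lt hj]
  exact coeff_frameConst_mul _ _ s

theorem cosetFrameCoeff_cosetG (s : ZMod d) {i : ℕ} (hi : i + 1 < n)
    (f : Fin (n + 1) → Frame d A) :
    cosetFrameCoeff n s (cosetG d n q (frameVar d) (frameConst d ∘ g) (frameConst d ∘ t) i f) =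
      g i * cosetFrameCoeff n s f := by
  rw [cosetFrameCoeff_apply, Fin.last, cosetG_gt _ hi]
  exact coeff_frameConst_mul _ _ s

variable [NeZero d]

variable (n g t) in
/-- The map `∑ₖ mₖ fₖ ↦ ∑_{k<n} g k ⋯ g (n - 2) fₖ(t (n - 1))` from the coset module to `A`, where
`mₖ` generates the `k`-th summand. The summand `k = n` of the trivial coset is sent to `0`. -/
def cosetBraidCoeff : (Fin (n + 1) → Frame d A) →ₗ[ℂ] A :=
  ∑ k : Fin n, LinearMap.mulLeft ℂ (tailProd g k (n - 1 - k)) ∘ₗ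
    frameEval d (t (n - 1)) ∘ₗ LinearMap.proj k.castSucc

theorem cosetBraidCoeff_apply (f : Fin (n + 1) → Frame d A) :
    cosetBraidCoeff n g t f = ∑ k : Fin n, tailProd g k (n - 1 - k) *
      frameEval d (t (n - 1)) (f ⟨k, by omega⟩) := by
  simp [cosetBraidCoeff, LinearMap.sum_apply]; rfl

theorem cosetBraidCoeff_mul_const (f : Fin (n + 1) → Frame d A) (a : A) :
    cosetBraidCoeff n g t (f * fun _ => frameConst d a) = cosetBraidCoeff n g t f * a := by
  simp only [cosetBraidCoeff_apply, Pi.mul_apply, frameEval_mul_const, Finset.sum_mul, mul_assoc]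

theorem YHFamily.cosetBraidCoeff_cosetT (h : YHFamily d n q g t) {j : ℕ} (hj : j < n)
    (f : Fin (n + 1) → Frame d A) :
    cosetBraidCoeff n g t (cosetT n (frameVar d) (frameConst d ∘ t) j f) =
      t j * cosetBraidCoeff n g t f := by
  simp only [cosetBraidCoeff_apply, cosetT_apply, Finset.mul_sum]
  refine Finset.sum_congr rfl fun ⟨k, hk⟩ _ => ?_
  have commute_last (i : ℕ) (hi : i < n) : Commute (t i) (t (n - 1)) :=
    h.t_comm _ _ hi (by omega)
  dsimp only
  rw [← mul_assoc]
  rcases lt_trichotomy k j with hkj | rfl | hkj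
  · obtain ⟨j, rfl⟩ := Nat.exists_eq_add_one.mpr (Nat.zero_lt_of_lt hkj)
    rw [insertFrame_succ (by omega), Function.comp_apply,
      frameEval_const_mul (commute_last _ (by omega)), ← mul_assoc,
      h.t_succ_mul_tailProd (by omega) (by omega) (by omega)]
  · rw [insertFrame_self, frameEval_var_mul (h.t_pow _ (by omega)), ← mul_assoc,
      h.t_mul_tailProd (by omega), show k + (n - 1 - k) = n - 1 by omega]
  · rw [insertFrame_lt hkj, Function.comp_apply, frameEval_const_mul (commute_last _ hj),
      ← mul_assoc, (h.commute_t_tailProd (by omega) hkj).eq]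

theorem YHFamily.tailProd_mul_frameEval_frameAvg_mul (h : YHFamily d n q g t) {i m : ℕ}
    (hi : i + (m + 1) < n) (b : Frame d A) :
    tailProd g i (m + 1) * frameEval d (t (i + (m + 1)))
        (frameAvg d (frameVar d) (frameConst d (t i)) * b) =
      frameAvg d (t i) (t (i + 1)) * tailProd g i (m + 1) * frameEval d (t (i + (m + 1))) b := by
  rw [linearMap_frameAvg_mul (frameEval_var_mul (h.t_pow _ hi))
    (frameEval_const_mul (h.t_comm _ _ (by omega) hi)), ← mul_assoc, h.tailProd_mul_frameAvg hi]

theorem YHFamily.cosetBraidCoeff_cosetG (h : YHFamily d n q g t) {i : ℕ} (hi : i + 1 < n)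
    (f : Fin (n + 1) → Frame d A) :
    cosetBraidCoeff n g t
        (cosetG d n q (frameVar d) (frameConst d ∘ g) (frameConst d ∘ t) i f) =
      g i * cosetBraidCoeff n g t f := by
  simp only [cosetBraidCoeff_apply, Finset.mul_sum]
  refine sum_eq_sum_of_eq_off_pair (a := ⟨i, by omega⟩) (b := ⟨i + 1, hi⟩) (by simp)
    (fun ⟨k, hk⟩ hki hki' => ?off_pair) ?pair
  case off_pair =>
    simp only [ne_eq, Fin.mk.injEq] at hki hki'
    have commute_last (i : ℕ) (hi : i + 1 < n - 1) : Commute (g i) (t (n - 1)) :=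
      (h.commute_t_g (by omega) (by omega) (by omega) (by omega)).symm
    dsimp only
    rw [← mul_assoc]
    rcases lt_or_gt_of_ne hki with hki | hki
    · obtain ⟨i, rfl⟩ := Nat.exists_eq_add_one.mpr (Nat.zero_lt_of_lt hki)
      rw [cosetG_lt (by omega) hki, Function.comp_apply,
        frameEval_const_mul (commute_last _ (by omega)), ← mul_assoc,
        h.g_succ_mul_tailProd (by omega) (by omega) (by omega)]
    · rw [cosetG_gt (by omega) (by omega), Function.comp_apply,
        frameEval_const_mul (commute_last _ (by omega)), ← mul_assoc,
        (h.commute_g_tailProd (by omega) (by omega)).eq]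
  case pair =>
    obtain ⟨m, rfl⟩ : ∃ m, n = i + (m + 1) + 1 := ⟨n - (i + 2), by omega⟩
    simp only [Nat.add_sub_cancel, show i + (m + 1) - i = m + 1 by omega,
      show i + (m + 1) - (i + 1) = m by omega]
    rw [cosetG_self (by omega) (by omega), cosetG_succ (by omega), map_add, map_smul,
      Function.comp_apply, mul_add, mul_smul_comm, h.tailProd_mul_frameEval_frameAvg_mul (by omega),
      ← mul_assoc, ← mul_assoc, h.g_mul_tailProd_succ (by omega), ← tailProd, add_mul,
      smul_mul_assoc]
    abel

end projections

section cosetSingle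

variable {F : Type*} [Ring F] [Algebra ℂ F] {d n : ℕ} {q : ℂ} {τ : F} {g t : ℕ → F}

theorem cosetT_single (j : ℕ) (k : Fin (n + 1)) (x : F) :
    cosetT n τ t j (Pi.single k x) = Pi.single k (insertFrame τ t k j * x) :=
  (Pi.single_mul_right (f := fun k : Fin (n + 1) => insertFrame τ t k j) (i := k) x).symm

theorem cosetG_single_last {i : ℕ} (hi : i + 1 < n) (x : F) :
    cosetG d n q τ g t i (Pi.single (Fin.last n) x) = Pi.single (Fin.last n) (g i * x) := by
  have single_eq_zero {k : ℕ} (hk : k < n) :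
      (Pi.single (Fin.last n) x : Fin (n + 1) → F) ⟨k, by omega⟩ = 0 := by
    simp [Fin.ext_iff, hk.ne]
  funext ⟨k, hk⟩
  rcases (Nat.le_of_lt_succ hk).eq_or_lt with rfl | hkn
  · rw [cosetG_gt hk hi, Fin.last, Pi.single_eq_same, Pi.single_eq_same]
  rw [Pi.single_eq_of_ne (Fin.ne_of_lt hkn)]
  rcases lt_trichotomy k i with hki | rfl | hki
  · obtain ⟨i, rfl⟩ := Nat.exists_eq_add_one.mpr (Nat.zero_lt_of_lt hki)
    rw [cosetG_lt hk hki, single_eq_zero hkn, mul_zero]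
  · rw [cosetG_self hk (by omega), single_eq_zero hkn, single_eq_zero hi, mul_zero, smul_zero,
      add_zero]
  rcases (show i + 1 ≤ k by omega).eq_or_lt with rfl | hki
  · rw [cosetG_succ, single_eq_zero (by omega)]
  · rw [cosetG_gt hk hki, single_eq_zero hkn, mul_zero]

theorem cosetG_last_single_last (x : F) :
    cosetG d (n + 1) q τ g t n (Pi.single (Fin.last (n + 1)) x) =
      Pi.single (Fin.last n).castSucc x := by
  have single_eq_zero {k : ℕ} (hk : k < n + 1) :
      (Pi.single (Fin.last (n + 1)) x : Fin (n + 2) → F) ⟨k, by omega⟩ = 0 := by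
    simp [Fin.ext_iff, hk.ne]
  funext ⟨k, hk⟩
  rcases lt_trichotomy k n with hkn | rfl | hkn
  · obtain ⟨n, rfl⟩ := Nat.exists_eq_add_one.mpr (Nat.zero_lt_of_lt hkn)
    rw [cosetG_lt hk hkn, single_eq_zero (by omega), mul_zero,
      Pi.single_eq_of_ne (Fin.ne_of_lt hkn)]
  · rw [cosetG_self hk (by omega), single_eq_zero k.lt_succ_self, mul_zero, smul_zero, add_zero]
    simp [Pi.single_apply, Fin.ext_iff]
  · obtain rfl : k = n + 1 := by omega
    rw [cosetG_succ, single_eq_zero (by omega), Pi.single_eq_of_ne (Fin.ne_of_gt hkn)]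

end cosetSingle

/-! ### The bimodule projections onto `Y_{d,n}(q)` -/

/-- The generator `t_{n+1}` of `Y_{d,n+1}(q)`, in the numbering from `1`. -/
def lastFrame (d n : ℕ) (q : ℂ) : YH d (n + 1) q := t d q (Fin.last n)

/-- The generator `g_{n+1}` of `Y_{d,n+2}(q)`, in the numbering from `1`. -/
def lastBraid (d n : ℕ) (q : ℂ) : YH d (n + 2) q := g d q n (Nat.lt_succ_self (n + 1))

theorem frameGen_last (d n : ℕ) (q : ℂ) : frameGen d (n + 1) q n = lastFrame d n q :=
  frameGen_eq n.lt_succ_self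

theorem braidGen_last (d n : ℕ) (q : ℂ) : braidGen d (n + 2) q n = lastBraid d n q :=
  braidGen_eq _

section projections

variable {d n : ℕ} {q : ℂ} [NeZero d]

variable (d n q) in
/-- The representation of `Y_{d,n+1}(q)` on the coset module with coefficients in the group algebra
of the cyclic group of order `d` over `Y_{d,n}(q)`. -/
def cosetRep : YH d (n + 1) q →ₐ[ℂ] Module.End ℂ (Fin (n + 1) → Frame d (YH d n q)) :=
  (((yhFamily_generators d n q).map (frameConst d)).coset commute_frameVar frameVar_pow_self).lift

theorem cosetRep_braidGen {i : ℕ} (hi : i < n) : cosetRep d n q (braidGen d (n + 1) q i) =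
    cosetG d n q (frameVar d) (frameConst d ∘ braidGen d n q) (frameConst d ∘ frameGen d n q) i :=
  YHFamily.lift_braidGen _ (by omega)

theorem cosetRep_frameGen {j : ℕ} (hj : j < n + 1) : cosetRep d n q (frameGen d (n + 1) q j) =
    cosetT n (frameVar d) (frameConst d ∘ frameGen d n q) j :=
  YHFamily.lift_frameGen _ hj

variable (d n q) in
/-- The generator of the summand of the trivial coset in the coset module. -/
def cosetVec : Fin (n + 1) → Frame d (YH d n q) := Pi.single (Fin.last n) 1

theorem cosetRep_mul_const (y : YH d (n + 1) q) (f : Fin (n + 1) → Frame d (YH d n q))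
    (a : YH d n q) : cosetRep d n q y (f * fun _ => frameConst d a) =
      cosetRep d n q y f * fun _ => frameConst d a := by
  refine (algHom_intertwine (ρ := cosetRep d n q) (σ := cosetRep d n q)
    (L := LinearMap.mulRight ℂ fun _ => frameConst d a) (fun i hi f => ?_) (fun j hj f => ?_)
    y f).symm
  · rw [cosetRep_braidGen (by omega)]
    exact (cosetG_mul_right i f _).symm
  · rw [cosetRep_frameGen hj]
    exact (cosetT_mul_right j f _).symm

theorem cosetRep_incl_cosetVec (a : YH d n q) : cosetRep d n q (incl d n q a) (cosetVec d n q) =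
    cosetVec d n q * fun _ => frameConst d a := by
  have intertwine := algHom_intertwine (ρ := Algebra.lmul ℂ (YH d n q))
    (σ := (cosetRep d n q).comp (incl d n q))
    (L := LinearMap.single ℂ _ (Fin.last n) ∘ₗ (frameConst d).toLinearMap)
    (fun i hi b => ?_) (fun j hj b => ?_) a 1
  · simpa [cosetVec, ← Pi.single_mul_left] using intertwine.symm
  · simp [incl_braidGen hi, cosetRep_braidGen (show i < n by omega), cosetG_single_last hi]
  · simp [incl_frameGen hj, cosetRep_frameGen (show j < n + 1 by omega), cosetT_single,
      insertFrame_lt hj]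

/-- The map of `Y_{d,n}(q)`-bimodules `Y_{d,n+1}(q) → Y_{d,n}(q)` with `t_{n+1}^s ↦ 1`,
`t_{n+1}^r ↦ 0` for `r ≠ s` modulo `d`, and `g_n ↦ 0`. -/
def frameCoeff (s : ZMod d) : YH d (n + 1) q →ₗ[ℂ] YH d n q :=
  cosetFrameCoeff n s ∘ₗ LinearMap.applyₗ (cosetVec d n q) ∘ₗ (cosetRep d n q).toLinearMap

/-- The map of `Y_{d,n}(q)`-bimodules `Y_{d,n+1}(q) → Y_{d,n}(q)` with `t_{n+1}^r ↦ 0` for all `r`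
and `g_n ↦ 1`. -/
def braidCoeff : YH d (n + 1) q →ₗ[ℂ] YH d n q :=
  cosetBraidCoeff n (braidGen d n q) (frameGen d n q) ∘ₗ LinearMap.applyₗ (cosetVec d n q) ∘ₗ
    (cosetRep d n q).toLinearMap

theorem frameCoeff_apply (s : ZMod d) (y : YH d (n + 1) q) :
    frameCoeff s y = cosetFrameCoeff n s (cosetRep d n q y (cosetVec d n q)) := rfl

theorem braidCoeff_apply (y : YH d (n + 1) q) : braidCoeff y =
    cosetBraidCoeff n (braidGen d n q) (frameGen d n q) (cosetRep d n q y (cosetVec d n q)) := rfl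

theorem frameCoeff_mul_incl (s : ZMod d) (y : YH d (n + 1) q) (a : YH d n q) :
    frameCoeff s (y * incl d n q a) = frameCoeff s y * a := by
  rw [frameCoeff_apply, map_mul, Module.End.mul_apply, cosetRep_incl_cosetVec, cosetRep_mul_const,
    cosetFrameCoeff_mul_const, frameCoeff_apply]

theorem braidCoeff_mul_incl (y : YH d (n + 1) q) (a : YH d n q) :
    braidCoeff (y * incl d n q a) = braidCoeff y * a := by
  rw [braidCoeff_apply, map_mul, Module.End.mul_apply, cosetRep_incl_cosetVec, cosetRep_mul_const,
    cosetBraidCoeff_mul_const, braidCoeff_apply]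

theorem frameCoeff_incl_mul (s : ZMod d) (a : YH d n q) (y : YH d (n + 1) q) :
    frameCoeff s (incl d n q a * y) = a * frameCoeff s y := by
  rw [frameCoeff_apply, map_mul, Module.End.mul_apply]
  refine algHom_intertwine (ρ := (cosetRep d n q).comp (incl d n q))
    (σ := Algebra.lmul ℂ (YH d n q)) (fun i hi f => ?_) (fun j hj f => ?_) a _
  · rw [AlgHom.comp_apply, incl_braidGen hi, cosetRep_braidGen (by omega)]
    exact cosetFrameCoeff_cosetG s hi f
  · rw [AlgHom.comp_apply, incl_frameGen hj, cosetRep_frameGen (by omega)]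
    exact cosetFrameCoeff_cosetT s hj f

theorem braidCoeff_incl_mul (a : YH d n q) (y : YH d (n + 1) q) :
    braidCoeff (incl d n q a * y) = a * braidCoeff y := by
  rw [braidCoeff_apply, map_mul, Module.End.mul_apply]
  refine algHom_intertwine (ρ := (cosetRep d n q).comp (incl d n q))
    (σ := Algebra.lmul ℂ (YH d n q)) (fun i hi f => ?_) (fun j hj f => ?_) a _
  · rw [AlgHom.comp_apply, incl_braidGen hi, cosetRep_braidGen (by omega)]
    exact (yhFamily_generators d n q).cosetBraidCoeff_cosetG hi f
  · rw [AlgHom.comp_apply, incl_frameGen hj, cosetRep_frameGen (by omega)]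
    exact (yhFamily_generators d n q).cosetBraidCoeff_cosetT hj f

theorem cosetRep_lastFrame_pow_cosetVec (r : ℕ) :
    cosetRep d n q (lastFrame d n q ^ r) (cosetVec d n q) =
      Pi.single (Fin.last n) (frameVar d ^ r) := by
  induction r with
  | zero => rw [pow_zero, pow_zero, map_one, Module.End.one_apply, cosetVec]
  | succ r ih =>
    rw [pow_succ', map_mul, Module.End.mul_apply, ih, ← frameGen_last,
      cosetRep_frameGen n.lt_succ_self, cosetT_single, Fin.val_last, insertFrame_self, pow_succ']

theorem cosetRep_lastBraid_cosetVec :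
    cosetRep d (n + 1) q (lastBraid d n q) (cosetVec d (n + 1) q) =
      Pi.single (Fin.last n).castSucc 1 := by
  rw [← braidGen_last, cosetRep_braidGen n.lt_succ_self, cosetVec, cosetG_last_single_last]

theorem frameCoeff_lastFrame_pow (s : ZMod d) (r : ℕ) :
    frameCoeff s (lastFrame d n q ^ r) = if (r : ZMod d) = s then 1 else 0 := by
  rw [frameCoeff_apply, cosetRep_lastFrame_pow_cosetVec, cosetFrameCoeff_apply,
    Pi.single_eq_same, frameVar_pow, AddMonoidAlgebra.coeff_single, Finsupp.single_apply]

theorem braidCoeff_lastFrame_pow (r : ℕ) : braidCoeff (lastFrame d n q ^ r) = 0 := by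
  rw [braidCoeff_apply, cosetRep_lastFrame_pow_cosetVec, cosetBraidCoeff_apply]
  refine Finset.sum_eq_zero fun k _ => ?_
  rw [Pi.single_eq_of_ne (Fin.ne_of_lt k.2), map_zero, mul_zero]

theorem frameCoeff_lastBraid (s : ZMod d) : frameCoeff s (lastBraid d n q) = 0 := by
  rw [frameCoeff_apply, cosetRep_lastBraid_cosetVec, cosetFrameCoeff_apply,
    Pi.single_eq_of_ne (Fin.ne_of_gt (Fin.castSucc_lt_last _))]
  rfl

theorem braidCoeff_lastBraid : braidCoeff (lastBraid d n q) = 1 := by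
  rw [braidCoeff_apply, cosetRep_lastBraid_cosetVec, cosetBraidCoeff, LinearMap.sum_apply,
    Finset.sum_eq_single (Fin.last n)]
  · simp [tailProd, frameEval_one]
  · intro k _ hk
    simp [Fin.castSucc_injective _ |>.ne hk]
  · simp

end projections

/-! ### The spanning set of `Y_{d,n+1}(q)` -/

section relations

variable {d n : ℕ} {q : ℂ}

variable (d n q) in
/-- The element `e_{n+1} g_{n+1}` of `Y_{d,n+2}(q)`, in the numbering from `1`. -/
def avgBraid : YH d (n + 2) q :=
  frameAvg d (incl d (n + 1) q (lastFrame d n q)) (lastFrame d (n + 1) q) * lastBraid d n q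

theorem incl_lastFrame : incl d (n + 1) q (lastFrame d n q) = frameGen d (n + 2) q n := by
  rw [← frameGen_last, incl_frameGen n.lt_succ_self]

theorem lastBraid_mul_lastBraid :
    lastBraid d n q * lastBraid d n q = 1 + (q - q⁻¹) • avgBraid d n q := by
  rw [avgBraid, incl_lastFrame, ← frameGen_last, ← braidGen_last]
  exact (yhFamily_generators d (n + 2) q).quad n (by omega)

theorem semiconjBy_lastBraid_lastFrame : SemiconjBy (lastBraid d n q) (lastFrame d (n + 1) q)
    (incl d (n + 1) q (lastFrame d n q)) := by
  rw [incl_lastFrame, ← frameGen_last, ← braidGen_last]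
  exact ((yhFamily_generators d (n + 2) q).t_mul_g_self (by omega)).symm

theorem semiconjBy_lastBraid_incl_lastFrame : SemiconjBy (lastBraid d n q)
    (incl d (n + 1) q (lastFrame d n q)) (lastFrame d (n + 1) q) := by
  rw [incl_lastFrame, ← frameGen_last, ← braidGen_last]
  exact ((yhFamily_generators d (n + 2) q).t_mul_g_succ (by omega)).symm

theorem lastFrame_pow_card : lastFrame d n q ^ d = 1 := by
  rw [← frameGen_last]
  exact (yhFamily_generators d (n + 1) q).t_pow n n.lt_succ_self

theorem lastBraid_mul_lastFrame_pow (s : ℕ) : lastBraid d n q * lastFrame d (n + 1) q ^ s =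
    incl d (n + 1) q (lastFrame d n q ^ s) * lastBraid d n q := by
  rw [map_pow]
  exact (semiconjBy_lastBraid_lastFrame.pow_right s).eq

theorem lastFrame_pow_mul_lastBraid (s : ℕ) : lastFrame d (n + 1) q ^ s * lastBraid d n q =
    lastBraid d n q * incl d (n + 1) q (lastFrame d n q ^ s) := by
  rw [map_pow]
  exact (semiconjBy_lastBraid_incl_lastFrame.pow_right s).eq.symm

theorem avgBraid_eq_sum : avgBraid d n q = (d : ℂ)⁻¹ • ∑ s ∈ Finset.range d,
    incl d (n + 1) q (lastFrame d n q ^ s) * lastBraid d n q *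
      incl d (n + 1) q (lastFrame d n q ^ (d - s)) := by
  simp only [avgBraid, frameAvg, smul_mul_assoc, Finset.sum_mul, mul_assoc,
    lastFrame_pow_mul_lastBraid, map_pow]

variable [NeZero d]

theorem commute_lastFrame_incl (a : YH d n q) : Commute (lastFrame d n q) (incl d n q a) := by
  have h := yhFamily_generators d (n + 1) q
  rw [← frameGen_last]
  refine commute_algHom (fun i hi => ?_) (fun j hj => ?_) a
  · rw [incl_braidGen hi]
    exact h.commute_t_g (by omega) (by omega) (by omega) (by omega)
  · rw [incl_frameGen hj]
    exact h.t_comm n j (by omega) (by omega)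

theorem commute_lastBraid_incl_incl (a : YH d n q) :
    Commute (lastBraid d n q) (incl d (n + 1) q (incl d n q a)) := by
  have h := yhFamily_generators d (n + 2) q
  rw [← braidGen_last, ← AlgHom.comp_apply]
  refine commute_algHom (fun i hi => ?_) (fun j hj => ?_) a
  · rw [AlgHom.comp_apply, incl_braidGen hi, incl_braidGen (by omega)]
    exact (h.far i n hi (by omega)).symm
  · rw [AlgHom.comp_apply, incl_frameGen hj, incl_frameGen (by omega)]
    exact (h.commute_t_g (by omega) (by omega) (by omega) (by omega)).symm

theorem lastFrame_mul_braid (a b : YH d (n + 1) q) :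
    lastFrame d (n + 1) q * (incl d (n + 1) q a * lastBraid d n q * incl d (n + 1) q b) =
      incl d (n + 1) q a * lastBraid d n q * incl d (n + 1) q (lastFrame d n q * b) := by
  rw [← mul_assoc, ← mul_assoc, (commute_lastFrame_incl a).eq, mul_assoc (incl _ _ _ a),
    ← semiconjBy_lastBraid_incl_lastFrame.eq, map_mul]
  simp only [mul_assoc]

theorem braid_mul_lastFrame (a b : YH d (n + 1) q) :
    incl d (n + 1) q a * lastBraid d n q * incl d (n + 1) q b * lastFrame d (n + 1) q =
      incl d (n + 1) q (a * lastFrame d n q) * lastBraid d n q * incl d (n + 1) q b := by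
  rw [mul_assoc, ← (commute_lastFrame_incl b).eq, ← mul_assoc, mul_assoc (incl _ _ _ a),
    semiconjBy_lastBraid_lastFrame.eq, map_mul]
  simp only [mul_assoc]

theorem avgBraid_mul_lastFrame_pow (s : ℕ) : avgBraid d n q * lastFrame d (n + 1) q ^ s =
    incl d (n + 1) q (lastFrame d n q ^ s) * avgBraid d n q := by
  have commute_avg : Commute (incl d (n + 1) q (lastFrame d n q ^ s))
      (frameAvg d (incl d (n + 1) q (lastFrame d n q)) (lastFrame d (n + 1) q)) :=
    semiconjBy_frameAvg (map_pow (incl d (n + 1) q) _ s ▸ Commute.pow_self _ s)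
      (commute_lastFrame_incl _).symm
  rw [avgBraid, mul_assoc, lastBraid_mul_lastFrame_pow, ← mul_assoc, ← mul_assoc, commute_avg.eq]

theorem lastBraid_mul_incl_frame_mul_lastBraid (u : YH d n q) (s : ℕ) :
    lastBraid d n q * incl d (n + 1) q (incl d n q u * lastFrame d n q ^ s) * lastBraid d n q =
      incl d (n + 1) q (incl d n q u) * lastFrame d (n + 1) q ^ s + (q - q⁻¹) •
        (incl d (n + 1) q (incl d n q u * lastFrame d n q ^ s) * avgBraid d n q) := by
  rw [map_mul, ← mul_assoc, (commute_lastBraid_incl_incl u).eq, mul_assoc, mul_assoc,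
    ← lastBraid_mul_lastFrame_pow, ← mul_assoc (lastBraid d n q), lastBraid_mul_lastBraid, add_mul,
    one_mul, mul_add, smul_mul_assoc, mul_smul_comm, avgBraid_mul_lastFrame_pow, ← mul_assoc]

theorem lastBraid_mul_incl_braid_mul_lastBraid (u v : YH d (n + 1) q) :
    lastBraid d (n + 1) q * incl d (n + 2) q (incl d (n + 1) q u * lastBraid d n q *
      incl d (n + 1) q v) * lastBraid d (n + 1) q =
    incl d (n + 2) q (incl d (n + 1) q u * lastBraid d n q) * lastBraid d (n + 1) q *
      incl d (n + 2) q (lastBraid d n q * incl d (n + 1) q v) := by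
  have braid := (yhFamily_generators d (n + 3) q).braid n (by omega)
  rw [← incl_braidGen (n := n + 2) (by omega), braidGen_last, braidGen_last] at braid
  simp only [map_mul]
  rw [← mul_assoc, ← mul_assoc, (commute_lastBraid_incl_incl u).eq]
  simp only [mul_assoc]
  rw [← (commute_lastBraid_incl_incl v).eq]
  congr 1
  simp only [← mul_assoc, braid]

end relations

/-- The elements `a t_{n+1}^s` and `a g_n b` of `Y_{d,n+1}(q)` with `a` and `b` in `Y_{d,n}(q)`, on
which the rules of a Markov trace can be applied. -/
inductive IsMarkovMonomial (d : ℕ) (q : ℂ) : ∀ n : ℕ, YH d (n + 1) q → Prop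
  | frame {n : ℕ} (a : YH d n q) (s : ℕ) :
    IsMarkovMonomial d q n (incl d n q a * lastFrame d n q ^ s)
  | braid {n : ℕ} (a b : YH d (n + 1) q) :
    IsMarkovMonomial d q (n + 1) (incl d (n + 1) q a * lastBraid d n q * incl d (n + 1) q b)

section spanning

variable (d n : ℕ) (q : ℂ)

/-- The span of the elements `a t_{n+1}^s` and `a g_n b` of `Y_{d,n+1}(q)`. -/
def markovSpan : Submodule ℂ (YH d (n + 1) q) :=
  Submodule.span ℂ {y | IsMarkovMonomial d q n y}

variable {d n q}

theorem IsMarkovMonomial.mem_markovSpan {y : YH d (n + 1) q} (hy : IsMarkovMonomial d q n y) :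
    y ∈ markovSpan d n q :=
  Submodule.subset_span hy

theorem map_mem_of_mem_markovSpan {V : Type*} [AddCommMonoid V] [Module ℂ V]
    {L : YH d (n + 1) q →ₗ[ℂ] V} {M : Submodule ℂ V}
    (h : ∀ y, IsMarkovMonomial d q n y → L y ∈ M) {y : YH d (n + 1) q}
    (hy : y ∈ markovSpan d n q) : L y ∈ M :=
  Submodule.span_le (p := M.comap L).mpr h hy

theorem incl_mul_mem_markovSpan (a : YH d n q) {x : YH d (n + 1) q} (hx : x ∈ markovSpan d n q) :
    incl d n q a * x ∈ markovSpan d n q := by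
  refine map_mem_of_mem_markovSpan (L := LinearMap.mulLeft ℂ (incl d n q a)) (fun y hy => ?_) hx
  rw [LinearMap.mulLeft_apply]
  cases hy with
  | frame b s =>
    rw [← mul_assoc, ← map_mul]
    exact (IsMarkovMonomial.frame _ _).mem_markovSpan
  | braid b c =>
    rw [← mul_assoc, ← mul_assoc, ← map_mul]
    exact (IsMarkovMonomial.braid _ _).mem_markovSpan

theorem avgBraid_mem_markovSpan : avgBraid d n q ∈ markovSpan d (n + 1) q := by
  rw [avgBraid_eq_sum]
  exact Submodule.smul_mem _ _ (Submodule.sum_mem _ fun s _ =>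
    (IsMarkovMonomial.braid _ _).mem_markovSpan)

variable [NeZero d]

theorem mul_incl_mem_markovSpan (a : YH d n q) {x : YH d (n + 1) q} (hx : x ∈ markovSpan d n q) :
    x * incl d n q a ∈ markovSpan d n q := by
  refine map_mem_of_mem_markovSpan (L := LinearMap.mulRight ℂ (incl d n q a)) (fun y hy => ?_) hx
  rw [LinearMap.mulRight_apply]
  cases hy with
  | frame b s =>
    rw [mul_assoc, ((commute_lastFrame_incl a).pow_left s).eq, ← mul_assoc, ← map_mul]
    exact (IsMarkovMonomial.frame _ _).mem_markovSpan
  | braid b c =>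
    rw [mul_assoc, ← map_mul]
    exact (IsMarkovMonomial.braid _ _).mem_markovSpan

theorem lastFrame_mul_mem_markovSpan {x : YH d (n + 1) q} (hx : x ∈ markovSpan d n q) :
    lastFrame d n q * x ∈ markovSpan d n q := by
  refine map_mem_of_mem_markovSpan (L := LinearMap.mulLeft ℂ (lastFrame d n q))
    (fun y hy => ?_) hx
  rw [LinearMap.mulLeft_apply]
  cases hy with
  | frame b s =>
    rw [← mul_assoc, (commute_lastFrame_incl b).eq, mul_assoc, ← pow_succ']
    exact (IsMarkovMonomial.frame _ _).mem_markovSpan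
  | braid b c =>
    rw [lastFrame_mul_braid]
    exact (IsMarkovMonomial.braid _ _).mem_markovSpan

theorem lastBraid_mul_incl_mul_lastBraid_mem_markovSpan {b : YH d (n + 1) q}
    (hb : b ∈ markovSpan d n q) :
    lastBraid d n q * incl d (n + 1) q b * lastBraid d n q ∈ markovSpan d (n + 1) q := by
  refine map_mem_of_mem_markovSpan (L := LinearMap.mulRight ℂ (lastBraid d n q) ∘ₗ
    LinearMap.mulLeft ℂ (lastBraid d n q) ∘ₗ (incl d (n + 1) q).toLinearMap) (fun y hy => ?_) hb
  simp only [LinearMap.comp_apply, AlgHom.toLinearMap_apply, LinearMap.mulLeft_apply,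
    LinearMap.mulRight_apply]
  cases hy with
  | frame u s =>
    rw [lastBraid_mul_incl_frame_mul_lastBraid]
    exact add_mem (IsMarkovMonomial.frame _ _).mem_markovSpan
      (Submodule.smul_mem _ _ (incl_mul_mem_markovSpan _ avgBraid_mem_markovSpan))
  | braid u v =>
    rw [lastBraid_mul_incl_braid_mul_lastBraid]
    exact (IsMarkovMonomial.braid _ _).mem_markovSpan

theorem lastBraid_mul_mem_markovSpan (ih : markovSpan d n q = ⊤) {x : YH d (n + 2) q}
    (hx : x ∈ markovSpan d (n + 1) q) : lastBraid d n q * x ∈ markovSpan d (n + 1) q := by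
  refine map_mem_of_mem_markovSpan (L := LinearMap.mulLeft ℂ (lastBraid d n q))
    (fun y hy => ?_) hx
  rw [LinearMap.mulLeft_apply]
  cases hy with
  | frame b s =>
    rw [← ((commute_lastFrame_incl b).pow_left s).eq, ← mul_assoc, lastBraid_mul_lastFrame_pow]
    exact (IsMarkovMonomial.braid _ _).mem_markovSpan
  | braid b c =>
    rw [← mul_assoc, ← mul_assoc]
    exact mul_incl_mem_markovSpan c
      (lastBraid_mul_incl_mul_lastBraid_mem_markovSpan (ih ▸ Submodule.mem_top))

theorem eq_top_of_generators_mul_mem {M : Submodule ℂ (YH d n q)} (h1 : 1 ∈ M)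
    (hg : ∀ i, i + 1 < n → ∀ x ∈ M, braidGen d n q i * x ∈ M)
    (ht : ∀ j, j < n → ∀ x ∈ M, frameGen d n q j * x ∈ M) : M = ⊤ := by
  let S : Subalgebra ℂ (YH d n q) :=
    { carrier := {y | ∀ x ∈ M, y * x ∈ M}
      mul_mem' := fun ha hb x hx => by rw [mul_assoc]; exact ha _ (hb x hx)
      add_mem' := fun ha hb x hx => by rw [add_mul]; exact add_mem (ha x hx) (hb x hx)
      algebraMap_mem' := fun c x hx => by
        rw [← Algebra.smul_def]; exact Submodule.smul_mem _ c hx }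
  have mem_S (y : YH d n q) : y ∈ S :=
    (eq_top_of_generators_mem (S := S) hg ht).ge Algebra.mem_top
  exact eq_top_iff.mpr fun y _ => mul_one y ▸ mem_S y 1 h1

theorem markovSpan_eq_top (n : ℕ) : markovSpan d n q = ⊤ := by
  have one_mem (n : ℕ) : 1 ∈ markovSpan d n q := by
    simpa using (IsMarkovMonomial.frame (1 : YH d n q) 0).mem_markovSpan
  have frameGen_mul_mem (n j : ℕ) (hj : j < n + 1) (x : YH d (n + 1) q)
      (hx : x ∈ markovSpan d n q) : frameGen d (n + 1) q j * x ∈ markovSpan d n q := by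
    rcases (Nat.le_of_lt_succ hj).eq_or_lt with rfl | hj
    · exact frameGen_last d j q ▸ lastFrame_mul_mem_markovSpan hx
    · exact incl_frameGen hj (d := d) (q := q) ▸ incl_mul_mem_markovSpan _ hx
  induction n with
  | zero =>
    exact eq_top_of_generators_mul_mem (one_mem 0) (fun i hi => by omega) (frameGen_mul_mem 0)
  | succ n ih =>
    refine eq_top_of_generators_mul_mem (one_mem _) (fun i hi x hx => ?_) (frameGen_mul_mem _)
    rcases (show i ≤ n by omega).eq_or_lt with rfl | hi
    · exact braidGen_last d i q ▸ lastBraid_mul_mem_markovSpan ih hx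
    · exact incl_braidGen (n := n + 1) (d := d) (q := q) (Nat.succ_lt_succ hi) ▸
        incl_mul_mem_markovSpan _ hx

theorem linearMap_ext_isMarkovMonomial {V : Type*} [AddCommMonoid V] [Module ℂ V]
    {L L' : YH d (n + 1) q →ₗ[ℂ] V} (h : ∀ y, IsMarkovMonomial d q n y → L y = L' y) : L = L' :=
  LinearMap.ext_on (markovSpan_eq_top n) h

theorem linearMap_ext_zero {V : Type*} [AddCommMonoid V] [Module ℂ V] {L L' : YH d 0 q →ₗ[ℂ] V}
    (h : L 1 = L' 1) : L = L' :=
  LinearMap.eqLocus_eq_top.mp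
    (eq_top_of_generators_mul_mem h (fun _ hi => by omega) (fun _ hj => by omega))

end spanning

/-! ### Uniqueness of the trace -/

section uniqueness

variable {d : ℕ} {q : ℂ} {tr tr' : (n : ℕ) → YH d n q →ₗ[ℂ] TraceRing d}

theorem IsMarkovTrace.apply_incl_mul_lastBraid_mul_incl (h : IsMarkovTrace d q tr) {n : ℕ}
    (a b : YH d (n + 1) q) :
    tr (n + 2) (incl d (n + 1) q a * lastBraid d n q * incl d (n + 1) q b) =
      MvPolynomial.X TraceVar.z * tr (n + 1) (b * a) := by
  rw [h.comm, ← mul_assoc, ← map_mul]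
  exact h.markov n (b * a)

theorem IsMarkovTrace.unique [NeZero d] (h : IsMarkovTrace d q tr)
    (h' : IsMarkovTrace d q tr') : tr = tr' := by
  funext n
  induction n with
  | zero => exact linearMap_ext_zero ((h.one 0).trans (h'.one 0).symm)
  | succ n ih =>
    refine linearMap_ext_isMarkovMonomial fun y hy => ?_
    cases hy with
    | frame a s =>
      rw [pow_eq_pow_mod s lastFrame_pow_card]
      rcases Nat.eq_zero_or_pos (s % d) with hs | hs
      · rw [hs, pow_zero, mul_one, h.compat, h'.compat, ih]
      · have hsd : s % d < d := Nat.mod_lt _ (NeZero.pos d)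
        exact (h.framing n a (s % d) hs hsd).trans (ih ▸ (h'.framing n a (s % d) hs hsd).symm)
    | braid a b =>
      rw [h.apply_incl_mul_lastBraid_mul_incl, h'.apply_incl_mul_lastBraid_mul_incl, ih]

end uniqueness

/-! ### Existence of the trace -/

/-- The linear map `φ` takes the same value on `a * b` and `b * a`. -/
def IsTracial {A V : Type*} [Ring A] [Algebra ℂ A] [AddCommMonoid V] [Module ℂ V]
    (φ : A →ₗ[ℂ] V) : Prop :=
  ∀ a b, φ (a * b) = φ (b * a)

namespace IsTracial

section ring

variable {A V : Type*} [Ring A] [Algebra ℂ A] [AddCommMonoid V] [Module ℂ V] {φ : A →ₗ[ℂ] V}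
  {g p r u v w : A}

theorem apply_mul_pow_mul_pow_mul (h : IsTracial φ) (hpr : Commute p r) (hg : SemiconjBy g r p)
    (hu : Commute r u) (hv : Commute r v) (hw : Commute r w) (k l : ℕ) :
    φ (u * g * v * (p ^ k * r ^ l * g) * w) = φ (u * (r ^ k * p ^ l * g) * v * g * w) := by
  have collect : u * g * v * (p ^ k * r ^ l * g) * w = u * p ^ l * g * v * g * w * r ^ k := by
    calc u * g * v * (p ^ k * r ^ l * g) * w
        = u * g * (v * r ^ l) * (p ^ k * g) * w := by
          rw [(hpr.pow_pow k l).eq]; simp only [mul_assoc]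
      _ = u * (g * r ^ l) * v * (g * r ^ k) * w := by
          rw [← (hv.pow_left l).eq, (hg.pow_right k).eq]; simp only [mul_assoc]
      _ = u * p ^ l * g * v * g * (r ^ k * w) := by
          rw [(hg.pow_right l).eq]; simp only [mul_assoc]
      _ = u * p ^ l * g * v * g * w * r ^ k := by
          rw [(hw.pow_left k).eq]; simp only [mul_assoc]
  rw [collect, h]
  simp only [← mul_assoc, (hu.pow_left k).eq]

theorem apply_mul_frameAvg_mul {d : ℕ} (h : IsTracial φ) (hpr : Commute p r)
    (hp : p ^ d = 1) (hr : r ^ d = 1) (hg : SemiconjBy g r p)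
    (hu : Commute r u) (hv : Commute r v) (hw : Commute r w) :
    φ (u * g * v * (frameAvg d p r * g) * w) = φ (u * (frameAvg d p r * g) * v * g * w) := by
  nth_rewrite 2 [frameAvg_comm hpr hp hr]
  simp only [frameAvg, smul_mul_assoc, mul_smul_comm, Finset.sum_mul, Finset.mul_sum, map_smul,
    map_sum, h.apply_mul_pow_mul_pow_mul hpr hg hu hv hw]

end ring

theorem of_generators {d n : ℕ} {q : ℂ} [NeZero d] {V : Type*} [AddCommMonoid V] [Module ℂ V]
    {φ : YH d n q →ₗ[ℂ] V}
    (hg : ∀ i, i + 1 < n → ∀ b, φ (braidGen d n q i * b) = φ (b * braidGen d n q i))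
    (ht : ∀ j, j < n → ∀ b, φ (frameGen d n q j * b) = φ (b * frameGen d n q j)) :
    IsTracial φ := by
  let S : Subalgebra ℂ (YH d n q) :=
    { carrier := {a | ∀ b, φ (a * b) = φ (b * a)}
      mul_mem' := fun {x y} hx hy b => by rw [mul_assoc, hx, mul_assoc, hy, mul_assoc]
      add_mem' := fun hx hy b => by rw [add_mul, mul_add, map_add, map_add, hx, hy]
      algebraMap_mem' := fun c b => by rw [Algebra.commutes] }
  have S_eq_top : S = ⊤ := eq_top_of_generators_mem hg ht
  exact fun a => S_eq_top.ge (Algebra.mem_top (x := a))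

end IsTracial

section existence

/-- The indeterminate `x_s`, with the convention `x_0 = 1`. -/
def framingVar (d s : ℕ) : TraceRing d :=
  if h : 1 ≤ s ∧ s < d then MvPolynomial.X (TraceVar.x s h.1 h.2) else 1

theorem framingVar_zero (d : ℕ) : framingVar d 0 = 1 := dif_neg (by omega)

theorem yhFamily_zero (d : ℕ) (q : ℂ) {A : Type*} [Ring A] [Algebra ℂ A] (g t : ℕ → A) :
    YHFamily d 0 q g t := by
  constructor <;> intros <;> omega

variable {d n : ℕ} {q : ℂ} [NeZero d]

variable (d q) in
/-- The Markov trace, defined by recursion on the number of strands through the bimodule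
projections of `Y_{d,n+1}(q)` onto `Y_{d,n}(q)`. -/
def markovTrace : (n : ℕ) → YH d n q →ₗ[ℂ] TraceRing d
  | 0 => (yhFamily_zero d q 1 1).lift.toLinearMap
  | n + 1 => ∑ s ∈ Finset.range d, framingVar d s • (markovTrace n ∘ₗ frameCoeff (s : ZMod d)) +
      (MvPolynomial.X TraceVar.z : TraceRing d) • (markovTrace n ∘ₗ braidCoeff)

theorem markovTrace_succ (y : YH d (n + 1) q) : markovTrace d q (n + 1) y =
    ∑ s ∈ Finset.range d, framingVar d s * markovTrace d q n (frameCoeff (s : ZMod d) y) +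
      MvPolynomial.X TraceVar.z * markovTrace d q n (braidCoeff y) := by
  simp [markovTrace]

theorem markovTrace_frame (a : YH d n q) (s : ℕ) :
    markovTrace d q (n + 1) (incl d n q a * lastFrame d n q ^ s) =
      framingVar d (s % d) * markovTrace d q n a := by
  rw [markovTrace_succ, braidCoeff_incl_mul, braidCoeff_lastFrame_pow, mul_zero, map_zero,
    mul_zero, add_zero, Finset.sum_eq_single (s % d)]
  · rw [frameCoeff_incl_mul, frameCoeff_lastFrame_pow, if_pos (by simp), mul_one]
  · intro r hr hrs
    rw [frameCoeff_incl_mul, frameCoeff_lastFrame_pow, if_neg, mul_zero, map_zero, mul_zero]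
    rw [ZMod.natCast_eq_natCast_iff', Nat.mod_eq_of_lt (Finset.mem_range.mp hr)]
    exact hrs.symm
  · exact fun hs => absurd (Finset.mem_range.mpr (Nat.mod_lt s (NeZero.pos d))) hs

theorem markovTrace_incl (a : YH d n q) :
    markovTrace d q (n + 1) (incl d n q a) = markovTrace d q n a := by
  simpa [framingVar_zero] using markovTrace_frame a 0

theorem markovTrace_one (n : ℕ) : markovTrace d q n 1 = 1 := by
  induction n with
  | zero => exact map_one (yhFamily_zero d q 1 1).lift
  | succ n ih => rw [← map_one (incl d n q), markovTrace_incl, ih]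

theorem markovTrace_braid (a b : YH d (n + 1) q) :
    markovTrace d q (n + 2) (incl d (n + 1) q a * lastBraid d n q * incl d (n + 1) q b) =
      MvPolynomial.X TraceVar.z * markovTrace d q (n + 1) (a * b) := by
  rw [markovTrace_succ, braidCoeff_mul_incl, braidCoeff_incl_mul, braidCoeff_lastBraid, mul_one,
    Finset.sum_eq_zero, zero_add]
  intro s _
  rw [frameCoeff_mul_incl, frameCoeff_incl_mul, frameCoeff_lastBraid, mul_zero, zero_mul,
    map_zero, mul_zero]

theorem markovTrace_avgBraid (a b : YH d (n + 1) q) :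
    markovTrace d q (n + 2) (incl d (n + 1) q a * avgBraid d n q * incl d (n + 1) q b) =
      MvPolynomial.X TraceVar.z * markovTrace d q (n + 1) (a * b) := by
  have summand (s : ℕ) (hs : s ∈ Finset.range d) : markovTrace d q (n + 2)
      (incl d (n + 1) q a * (incl d (n + 1) q (lastFrame d n q ^ s) * lastBraid d n q *
        incl d (n + 1) q (lastFrame d n q ^ (d - s))) * incl d (n + 1) q b) =
      MvPolynomial.X TraceVar.z * markovTrace d q (n + 1) (a * b) := by
    rw [mul_assoc, mul_assoc, ← map_mul, ← mul_assoc, ← mul_assoc, ← map_mul, markovTrace_braid,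
      mul_assoc, ← mul_assoc (_ ^ s), ← pow_add, Nat.add_sub_cancel' (Finset.mem_range.mp hs).le,
      lastFrame_pow_card, one_mul]
  rw [avgBraid_eq_sum, mul_smul_comm, smul_mul_assoc, Finset.mul_sum, Finset.sum_mul, map_smul,
    map_sum, Finset.sum_congr rfl summand, Finset.sum_const, Finset.card_range,
    ← Nat.cast_smul_eq_nsmul ℂ, inv_smul_smul₀ (NeZero.ne _)]

theorem markovTrace_incl_mul_comm (hn : IsTracial (markovTrace d q n)) (a : YH d n q)
    (y : YH d (n + 1) q) : markovTrace d q (n + 1) (incl d n q a * y) =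
      markovTrace d q (n + 1) (y * incl d n q a) := by
  simp only [markovTrace_succ, frameCoeff_incl_mul, frameCoeff_mul_incl, braidCoeff_incl_mul,
    braidCoeff_mul_incl, hn a]

theorem markovTrace_lastFrame_mul_comm (hn : IsTracial (markovTrace d q n)) (y : YH d (n + 1) q) :
    markovTrace d q (n + 1) (lastFrame d n q * y) =
      markovTrace d q (n + 1) (y * lastFrame d n q) := by
  suffices eq_right : markovTrace d q (n + 1) ∘ₗ LinearMap.mulLeft ℂ (lastFrame d n q) =
      markovTrace d q (n + 1) ∘ₗ LinearMap.mulRight ℂ (lastFrame d n q) from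
    LinearMap.congr_fun eq_right y
  refine linearMap_ext_isMarkovMonomial fun y hy => ?_
  simp only [LinearMap.comp_apply, LinearMap.mulLeft_apply, LinearMap.mulRight_apply]
  cases hy with
  | frame a s =>
    rw [← mul_assoc, (commute_lastFrame_incl a).eq, mul_assoc, mul_assoc, ← pow_succ', ← pow_succ]
  | braid a b =>
    rw [lastFrame_mul_braid, braid_mul_lastFrame, markovTrace_braid, markovTrace_braid, mul_assoc]

variable (d n q) in
/-- The bilinear form `(a, b) ↦ tr(g_{n+1} a g_{n+1} b)` on `Y_{d,n+1}(q)`. Its symmetry is the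
heart of the trace property. -/
def sandwichForm : YH d (n + 1) q →ₗ[ℂ] YH d (n + 1) q →ₗ[ℂ] TraceRing d :=
  LinearMap.mk₂ ℂ (fun a b => markovTrace d q (n + 2)
      (lastBraid d n q * incl d (n + 1) q a * lastBraid d n q * incl d (n + 1) q b))
    (by simp [mul_add, add_mul]) (by simp) (by simp [mul_add]) (by simp)

theorem sandwichForm_apply (a b : YH d (n + 1) q) : sandwichForm d n q a b =
    markovTrace d q (n + 2)
      (lastBraid d n q * incl d (n + 1) q a * lastBraid d n q * incl d (n + 1) q b) := rfl

theorem sandwichForm_frame (u : YH d n q) (s : ℕ) (b : YH d (n + 1) q) :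
    sandwichForm d n q (incl d n q u * lastFrame d n q ^ s) b =
      framingVar d (s % d) * markovTrace d q (n + 1) (incl d n q u * b) +
        (q - q⁻¹) • (MvPolynomial.X TraceVar.z *
          markovTrace d q (n + 1) (incl d n q u * lastFrame d n q ^ s * b)) := by
  rw [sandwichForm_apply, lastBraid_mul_incl_frame_mul_lastBraid, add_mul, smul_mul_assoc, map_add,
    map_smul, markovTrace_avgBraid, mul_assoc, ((commute_lastFrame_incl b).pow_left s).eq,
    ← mul_assoc, ← map_mul, markovTrace_frame]

theorem sandwichForm_braid (u v : YH d (n + 1) q) (b : YH d (n + 2) q) :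
    sandwichForm d (n + 1) q (incl d (n + 1) q u * lastBraid d n q * incl d (n + 1) q v) b =
      MvPolynomial.X TraceVar.z * (markovTrace d q (n + 2) (incl d (n + 1) q (u * v) * b) +
        (q - q⁻¹) • markovTrace d q (n + 2)
          (incl d (n + 1) q u * avgBraid d n q * incl d (n + 1) q v * b)) := by
  rw [sandwichForm_apply, lastBraid_mul_incl_braid_mul_lastBraid, mul_assoc, ← map_mul,
    markovTrace_braid, ← map_smul, ← map_add]
  congr 2
  rw [mul_assoc, mul_assoc, ← mul_assoc (lastBraid d n q), lastBraid_mul_lastBraid]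
  simp only [map_mul, add_mul, mul_add, one_mul, smul_mul_assoc, mul_smul_comm, mul_assoc]

theorem sandwichForm_frame_frame (u v : YH d n q) (s r : ℕ) :
    sandwichForm d n q (incl d n q u * lastFrame d n q ^ s) (incl d n q v * lastFrame d n q ^ r) =
      framingVar d (s % d) * (framingVar d (r % d) * markovTrace d q n (u * v)) +
        (q - q⁻¹) • (MvPolynomial.X TraceVar.z *
          (framingVar d ((s + r) % d) * markovTrace d q n (u * v))) := by
  have mul_frames : incl d n q u * lastFrame d n q ^ s * (incl d n q v * lastFrame d n q ^ r) =
      incl d n q (u * v) * lastFrame d n q ^ (s + r) := by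
    rw [mul_assoc, ← mul_assoc (_ ^ s), ((commute_lastFrame_incl v).pow_left s).eq, map_mul,
      pow_add]
    simp only [mul_assoc]
  rw [sandwichForm_frame, mul_frames, ← mul_assoc (incl d n q u), ← map_mul, markovTrace_frame,
    markovTrace_frame]

theorem sandwichForm_frame_braid (u v w : YH d (n + 1) q) (s : ℕ) :
    sandwichForm d (n + 1) q (incl d (n + 1) q u * lastFrame d (n + 1) q ^ s)
        (incl d (n + 1) q v * lastBraid d n q * incl d (n + 1) q w) =
      framingVar d (s % d) *
          (MvPolynomial.X TraceVar.z * markovTrace d q (n + 1) (u * v * w)) +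
        (q - q⁻¹) • (MvPolynomial.X TraceVar.z * (MvPolynomial.X TraceVar.z *
          markovTrace d q (n + 1) (u * v * lastFrame d n q ^ s * w))) := by
  have move_frame : lastFrame d (n + 1) q ^ s * (incl d (n + 1) q v * lastBraid d n q) =
      incl d (n + 1) q v * lastBraid d n q * incl d (n + 1) q (lastFrame d n q ^ s) := by
    rw [← mul_assoc, ((commute_lastFrame_incl v).pow_left s).eq, mul_assoc,
      lastFrame_pow_mul_lastBraid, mul_assoc]
  have mul_braid : incl d (n + 1) q u * (incl d (n + 1) q v * lastBraid d n q *
      incl d (n + 1) q w) = incl d (n + 1) q (u * v) * lastBraid d n q * incl d (n + 1) q w := by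
    simp only [map_mul, mul_assoc]
  have mul_frame_braid : incl d (n + 1) q u * lastFrame d (n + 1) q ^ s *
      (incl d (n + 1) q v * lastBraid d n q * incl d (n + 1) q w) =
      incl d (n + 1) q (u * v) * lastBraid d n q *
        incl d (n + 1) q (lastFrame d n q ^ s * w) := by
    rw [mul_assoc, ← mul_assoc (_ ^ s), move_frame]
    simp only [map_mul, mul_assoc]
  rw [sandwichForm_frame, mul_braid, mul_frame_braid, markovTrace_braid, markovTrace_braid,
    mul_assoc _ (_ ^ s)]

theorem sandwichForm_braid_frame (u v w : YH d (n + 1) q) (s : ℕ) :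
    sandwichForm d (n + 1) q (incl d (n + 1) q v * lastBraid d n q * incl d (n + 1) q w)
        (incl d (n + 1) q u * lastFrame d (n + 1) q ^ s) =
      MvPolynomial.X TraceVar.z *
        (framingVar d (s % d) * markovTrace d q (n + 1) (v * w * u) +
          (q - q⁻¹) • (MvPolynomial.X TraceVar.z *
            markovTrace d q (n + 1) (v * lastFrame d n q ^ s * (w * u)))) := by
  have mul_frame : incl d (n + 1) q v * avgBraid d n q * incl d (n + 1) q w *
      (incl d (n + 1) q u * lastFrame d (n + 1) q ^ s) =
      incl d (n + 1) q (v * lastFrame d n q ^ s) * avgBraid d n q * incl d (n + 1) q (w * u) := by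
    rw [← mul_assoc, mul_assoc _ (incl _ _ _ w), ← map_mul, mul_assoc,
      ← ((commute_lastFrame_incl _).pow_left s).eq, ← mul_assoc, mul_assoc _ (avgBraid d n q),
      avgBraid_mul_lastFrame_pow, ← mul_assoc, ← map_mul]
  rw [sandwichForm_braid, mul_frame, markovTrace_avgBraid, ← mul_assoc, ← map_mul,
    markovTrace_frame]

theorem sandwichForm_braid_braid (u v w x : YH d (n + 1) q) :
    sandwichForm d (n + 1) q (incl d (n + 1) q u * lastBraid d n q * incl d (n + 1) q v)
        (incl d (n + 1) q w * lastBraid d n q * incl d (n + 1) q x) =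
      MvPolynomial.X TraceVar.z *
        (MvPolynomial.X TraceVar.z * markovTrace d q (n + 1) (u * v * w * x) +
          (q - q⁻¹) • markovTrace d q (n + 2) (incl d (n + 1) q u * avgBraid d n q *
            incl d (n + 1) q (v * w) * lastBraid d n q * incl d (n + 1) q x)) := by
  rw [sandwichForm_braid, ← markovTrace_braid]
  simp only [map_mul, mul_assoc]

theorem markovTrace_move_avgBraid (hn : IsTracial (markovTrace d q (n + 2)))
    (u v w : YH d (n + 1) q) :
    markovTrace d q (n + 2) (incl d (n + 1) q u * lastBraid d n q * incl d (n + 1) q v *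
        avgBraid d n q * incl d (n + 1) q w) =
      markovTrace d q (n + 2) (incl d (n + 1) q u * avgBraid d n q * incl d (n + 1) q v *
        lastBraid d n q * incl d (n + 1) q w) :=
  hn.apply_mul_frameAvg_mul (commute_lastFrame_incl _).symm
    (by rw [← map_pow, lastFrame_pow_card, map_one]) lastFrame_pow_card
    semiconjBy_lastBraid_lastFrame (commute_lastFrame_incl u) (commute_lastFrame_incl v)
    (commute_lastFrame_incl w)

theorem sandwichForm_frame_braid_comm (hn : IsTracial (markovTrace d q (n + 1)))
    (u v w : YH d (n + 1) q) (s : ℕ) :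
    sandwichForm d (n + 1) q (incl d (n + 1) q u * lastFrame d (n + 1) q ^ s)
        (incl d (n + 1) q v * lastBraid d n q * incl d (n + 1) q w) =
      sandwichForm d (n + 1) q (incl d (n + 1) q v * lastBraid d n q * incl d (n + 1) q w)
        (incl d (n + 1) q u * lastFrame d (n + 1) q ^ s) := by
  rw [sandwichForm_frame_braid, sandwichForm_braid_frame, hn (v * w) u, ← mul_assoc _ w u,
    hn (v * _ * w) u]
  simp only [mul_add, mul_smul_comm, mul_assoc, mul_left_comm (framingVar d (s % d))]

theorem sandwichForm_braid_braid_comm (hn : IsTracial (markovTrace d q (n + 1)))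
    (hn' : IsTracial (markovTrace d q (n + 2))) (u v w x : YH d (n + 1) q) :
    sandwichForm d (n + 1) q (incl d (n + 1) q u * lastBraid d n q * incl d (n + 1) q v)
        (incl d (n + 1) q w * lastBraid d n q * incl d (n + 1) q x) =
      sandwichForm d (n + 1) q (incl d (n + 1) q w * lastBraid d n q * incl d (n + 1) q x)
        (incl d (n + 1) q u * lastBraid d n q * incl d (n + 1) q v) := by
  have rotate : markovTrace d q (n + 2) (incl d (n + 1) q w * avgBraid d n q *
      incl d (n + 1) q (x * u) * lastBraid d n q * incl d (n + 1) q v) =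
      markovTrace d q (n + 2) (incl d (n + 1) q u * lastBraid d n q * incl d (n + 1) q (v * w) *
        avgBraid d n q * incl d (n + 1) q x) := by
    have cyclic := hn' (incl d (n + 1) q w * avgBraid d n q * incl d (n + 1) q x)
      (incl d (n + 1) q u * lastBraid d n q * incl d (n + 1) q v)
    simpa only [map_mul, mul_assoc] using cyclic
  rw [sandwichForm_braid_braid, sandwichForm_braid_braid, rotate, markovTrace_move_avgBraid hn',
    mul_assoc (u * v), mul_assoc (w * x), hn (u * v)]

theorem sandwichForm_comm (hn : ∀ m ≤ n + 1, IsTracial (markovTrace d q m))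
    (a b : YH d (n + 1) q) : sandwichForm d n q a b = sandwichForm d n q b a := by
  suffices eq_flip : sandwichForm d n q = (sandwichForm d n q).flip from
    LinearMap.congr_fun₂ eq_flip a b
  refine linearMap_ext_isMarkovMonomial fun a ha => linearMap_ext_isMarkovMonomial fun b hb => ?_
  rw [LinearMap.flip_apply]
  cases ha with
  | frame u s =>
    cases hb with
    | frame v r =>
      rw [sandwichForm_frame_frame, sandwichForm_frame_frame, hn n n.le_succ u v, add_comm s r,
        mul_left_comm (framingVar d (s % d))]
    | braid v w => exact sandwichForm_frame_braid_comm (hn _ (Nat.le_succ _)) u v w s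
  | braid v w =>
    cases hb with
    | frame u s => exact (sandwichForm_frame_braid_comm (hn _ (Nat.le_succ _)) u v w s).symm
    | braid u x =>
      exact sandwichForm_braid_braid_comm (hn _ (Nat.le_succ _)) (hn _ le_rfl) v w u x

theorem markovTrace_lastBraid_mul_comm (hn : ∀ m ≤ n + 1, IsTracial (markovTrace d q m))
    (y : YH d (n + 2) q) : markovTrace d q (n + 2) (lastBraid d n q * y) =
      markovTrace d q (n + 2) (y * lastBraid d n q) := by
  suffices eq_right : markovTrace d q (n + 2) ∘ₗ LinearMap.mulLeft ℂ (lastBraid d n q) =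
      markovTrace d q (n + 2) ∘ₗ LinearMap.mulRight ℂ (lastBraid d n q) from
    LinearMap.congr_fun eq_right y
  refine linearMap_ext_isMarkovMonomial fun y hy => ?_
  simp only [LinearMap.comp_apply, LinearMap.mulLeft_apply, LinearMap.mulRight_apply]
  cases hy with
  | frame a s =>
    rw [← ((commute_lastFrame_incl a).pow_left s).eq, ← mul_assoc, lastBraid_mul_lastFrame_pow,
      markovTrace_braid, ((commute_lastFrame_incl a).pow_left s).eq, mul_assoc,
      lastFrame_pow_mul_lastBraid, ← mul_assoc, markovTrace_braid, hn (n + 1) le_rfl]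
  | braid a b =>
    have symm := sandwichForm_comm hn a b
    rw [sandwichForm_apply, sandwichForm_apply] at symm
    rw [← mul_assoc, ← mul_assoc, symm,
      ← markovTrace_incl_mul_comm (hn (n + 1) le_rfl)]
    simp only [mul_assoc]

theorem isTracial_markovTrace (n : ℕ) : IsTracial (markovTrace d q n) := by
  induction n using Nat.strong_induction_on with
  | _ n ih =>
  cases n with
  | zero => exact .of_generators (fun _ hi => by omega) (fun _ hj => by omega)
  | succ n =>
    have incl_comm := markovTrace_incl_mul_comm (ih n n.lt_succ_self)
    refine .of_generators (fun i hi b => ?_) (fun j hj b => ?_)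
    · rcases (Nat.le_of_lt_succ hi).eq_or_lt with rfl | hi
      · rw [braidGen_last]
        exact markovTrace_lastBraid_mul_comm (fun m hm => ih m (Nat.lt_succ_of_le hm)) b
      · rw [← incl_braidGen hi, incl_comm]
    · rcases (Nat.le_of_lt_succ hj).eq_or_lt with rfl | hj
      · rw [frameGen_last]
        exact markovTrace_lastFrame_mul_comm (ih j j.lt_succ_self) b
      · rw [← incl_frameGen hj, incl_comm]

variable (d q) in
theorem isMarkovTrace_markovTrace : IsMarkovTrace d q (markovTrace d q) where
  compat _ := markovTrace_incl
  comm := isTracial_markovTrace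
  one := markovTrace_one
  markov m a := by simpa [lastBraid] using markovTrace_braid a 1
  framing n a s h₁ h₂ := by
    have h := markovTrace_frame a s
    rwa [Nat.mod_eq_of_lt h₂, framingVar, dif_pos ⟨h₁, h₂⟩] at h

end existence

/-! ### Inversion -/

section inversion

theorem reverse_one (d n : ℕ) (q : ℂ) : reverse d n q 1 = 1 := by
  simp [reverse]

theorem reverse_t_pow (d : ℕ) {n : ℕ} (q : ℂ) (j : Fin n) (s : ℕ) :
    reverse d n q (t d q j ^ s) = t d q j ^ s := by
  induction s with
  | zero => rw [pow_zero, reverse_one]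
  | succ s ih => rw [pow_succ, reverse_mul, ih, reverse_t, ← pow_succ', ← pow_succ]

variable {d n : ℕ} {q : ℂ}

theorem reverse_braidGen {i : ℕ} (hi : i + 1 < n) :
    reverse d n q (braidGen d n q i) = braidGen d n q i := by
  rw [braidGen_eq hi, reverse_g]

theorem reverse_frameGen {j : ℕ} (hj : j < n) :
    reverse d n q (frameGen d n q j) = frameGen d n q j := by
  rw [frameGen_eq hj, reverse_t]

theorem reverse_incl [NeZero d] (a : YH d n q) :
    reverse d (n + 1) q (incl d n q a) = incl d n q (reverse d n q a) := by
  let S : Subalgebra ℂ (YH d n q) := AlgHom.equalizer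
    ((reverseHom d (n + 1) q).comp (incl d n q)) ((AlgHom.op (incl d n q)).comp (reverseHom d n q))
  have mem_S {a : YH d n q} :
      a ∈ S ↔ reverse d (n + 1) q (incl d n q a) = incl d n q (reverse d n q a) :=
    (AlgHom.mem_equalizer _ _ _).trans MulOpposite.unop_injective.eq_iff.symm
  have S_eq_top : S = ⊤ := eq_top_of_generators_mem
    (fun i hi => by
      rw [mem_S, reverse_braidGen hi, incl_braidGen hi, reverse_braidGen (Nat.lt_succ_of_lt hi)])
    (fun j hj => by
      rw [mem_S, reverse_frameGen hj, incl_frameGen hj, reverse_frameGen (Nat.lt_succ_of_lt hj)])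
  exact mem_S.mp (S_eq_top.ge Algebra.mem_top)

theorem IsMarkovTrace.reverse [NeZero d] {tr : (n : ℕ) → YH d n q →ₗ[ℂ] TraceRing d}
    (h : IsMarkovTrace d q tr) :
    IsMarkovTrace d q (fun n => tr n ∘ₗ YokonumaHecke.reverse d n q) where
  compat n a := by
    rw [LinearMap.comp_apply, LinearMap.comp_apply, reverse_incl, h.compat]
  comm n a b := by
    rw [LinearMap.comp_apply, LinearMap.comp_apply, reverse_mul, reverse_mul, h.comm]
  one n := by rw [LinearMap.comp_apply, reverse_one, h.one]
  markov m a := by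
    rw [LinearMap.comp_apply, LinearMap.comp_apply, reverse_mul, reverse_incl, reverse_g,
      h.comm, h.markov]
  framing n a s h₁ h₂ := by
    rw [LinearMap.comp_apply, LinearMap.comp_apply, reverse_mul, reverse_incl, reverse_t_pow,
      h.comm, h.framing n _ s h₁ h₂]

theorem reverse_ofModular (x : ModularFramedBraidGroup d n) :
    reverse d n q (ofModular d n q x) = ofModular d n q (modularReverseHom d n x).unop := by
  simp [reverse, reverseHom, ofModular, MonoidAlgebra.lift_of, -MonoidAlgebra.of_apply]

theorem toModular_framedReverse (α : FramedBraidGroup n) :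
    toModular d n (framedReverse n α) = (modularReverseHom d n (toModular d n α)).unop := by
  have op_comp : (MonoidHom.op (toModular d n)).comp (framedReverseHom n) =
      (modularReverseHom d n).comp (toModular d n) :=
    PresentedGroup.ext fun x => by simp [framedReverseHom, modularReverseHom, toModular]
  exact congrArg MulOpposite.unop (DFunLike.congr_fun op_comp α)

theorem ofFramedBraid_framedReverse (α : FramedBraidGroup n) :
    ofFramedBraid d n q (framedReverse n α) = reverse d n q (ofFramedBraid d n q α) := by
  simp only [ofFramedBraid, MonoidHom.comp_apply, toModular_framedReverse, reverse_ofModular]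

end inversion

end YokonumaHecke


end

theorem mainTheorem7 (d : ℕ) (hd : 1 ≤ d) (q : ℂ) (hq : q ≠ 0) :
    ∃ trd : (n : ℕ) → YokonumaHecke.YH d n q →ₗ[ℂ] YokonumaHecke.TraceRing d,
      YokonumaHecke.IsMarkovTrace d q trd ∧
      (∀ tr' : (n : ℕ) → YokonumaHecke.YH d n q →ₗ[ℂ] YokonumaHecke.TraceRing d,
        YokonumaHecke.IsMarkovTrace d q tr' → tr' = trd) ∧
      (∀ (n : ℕ) (a : YokonumaHecke.YH d n q),
        trd n a = trd n (YokonumaHecke.reverse d n q a)) ∧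
      (∀ (n : ℕ) (α : YokonumaHecke.FramedBraidGroup n),
        trd n (YokonumaHecke.ofFramedBraid d n q α) =
          trd n (YokonumaHecke.ofFramedBraid d n q (YokonumaHecke.framedReverse n α))) := by
  have : NeZero d := ⟨Nat.one_le_iff_ne_zero.mp hd⟩
  have markov := YokonumaHecke.isMarkovTrace_markovTrace d q
  have eq_reverse (n : ℕ) (a : YokonumaHecke.YH d n q) : YokonumaHecke.markovTrace d q n a =
      YokonumaHecke.markovTrace d q n (YokonumaHecke.reverse d n q a) :=
    LinearMap.congr_fun (congrFun (markov.unique markov.reverse) n) a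
  refine ⟨YokonumaHecke.markovTrace d q, markov, fun tr' h' => h'.unique markov, eq_reverse,
    fun n α => ?_⟩
  rw [YokonumaHecke.ofFramedBraid_framedReverse]
  exact eq_reverse n _
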